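/- **Setting.** Let $(U,d)$ be a finite metric space with $n$ points. An *ordinal profile* gives for every $v\in U$ a ranking of all points of $U$; it is *consistent* with $d$ if $u$ being ranked before $u'$ by $v$ implies $d(u,v)\le d(u',v)$. An instance of the *ordinal fair $k$-center problem* consists of $k\ge 1$, a profile consistent with $d$, a partition $G_1,\dots,G_t$ of $U$ and requirements $\alpha_1,\dots,\alpha_t\in\mathbb{N}$; $d$ is unknown, but a deterministic algorithm may adaptively query values $d(u,v)$. A set $S\subseteq U$ is *feasible* if $|S|=k$ and $|S\cap G_i|\ge\alpha_i$ for all $i$; $\mathrm{cost}(S)=\max_{u\in U}\min_{s\in S}d(u,s)$. The *distortion* of an algorithm is the supremum, over all finite metric spaces, consistent profiles and instances with a feasible solution, of the cost of its output divided by the minimum cost of a feasible set (with $0/0=0$). **Algorithm.** Replace the groups by $k$ groups $G'_1,\dots,G'_k$ with unit requirement: $\alpha_i$ copies of each $G_i$ and $k-\sum_i\alpha_i$ copies of $U$. For an ordered sequence $T=(t_1,\dots,t_k)$ of centers let $T_\ell=(t_1,\dots,t_\ell)$, let $H^\ell_\lambda$ be the bipartite graph joining $s\in T_\ell$ to $G'_j$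 when $d(s,G'_j)\le\lambda$, and let $\lambda_\ell$ be the least $\lambda$ for which $H^\ell_\lambda$ has a matching covering $T_\ell$. 1. *Initial phase.* Compute $T$ by an ordinal farthest-first traversal for $k$-center without fairness. For each center it records the distance (one query) to the last-ranked point of its cluster; a cluster consists of the points that rank this center first among the centers. To add a center, take the center with the largest recorded distance $b$. If its recorded point is still the last-ranked point of its cluster, that point is the next center. Otherwise query the distance $r$ to the present last-ranked point and record it; if $2r\ge b$, that point is the next center, else repeat. 2. *Main phase.* Let $P(\ell)$ be the predicate $4\lambda_\ell\le\mathrm{cost}(T_\ell)$, evaluated by testing whether $H^\ell_\lambda$ with $\lambda=\mathrm{cost}(T_\ell)/4$ has a matching covering $T_\ell$, where the edges at each center are found by binary search in the rank order of the groups. If $P(1)$ fails put $\hat\ell=1$; otherwise, if $P(k)$ holds put $\hat\ell=k$; otherwise find by binary search $L$ with $P(L)$ true and $P(L+1)$ false, compute $\lambda_{L+1}$, and put $\hat\ell=L$ if $\mathrm{cost}(T_L)\le4\lambda_{L+1}$ and $\hat\ell=L+1$ otherwise. 3. *Computing $\lambda_\ell$.* Keep for each $s\in T_\ell$ the list of remaining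 candidate distances $d(s,G'_j)$, sorted by the ranking of $s$. In each round query the median of each list, take as pivot $\tau$ a median of these medians weighted by the list lengths, construct $H^\ell_\tau$, and discard the candidates $\ge\tau$ if it has a matching covering $T_\ell$ and those $\le\tau$ otherwise; after at most $\lfloor\log_{4/3}(k\ell)\rfloor+1$ rounds return the smallest threshold found feasible. 4. *Final phase.* Compute $\lambda_{\hat\ell}$ and a matching of $H^{\hat\ell}_{\lambda_{\hat\ell}}$ covering $T_{\hat\ell}$. Select for each $s\in T_{\hat\ell}$ the point of its matched group closest to $s$ and one arbitrary point of each unmatched group, and supplement the selected set by arbitrary points to a feasible set. **Theorem.** The algorithm has distortion at most $5$, and on every instance that has a feasible solution it returns a feasible solution. It makes $O(k\log^2k)$ distance queries: there is an absolute constant $C$ such that it makes at most $C\,k\log^2k$ queries if $k\ge2$, and at most $C$ queries if $k=1$. Its initial phase has distortion at most $4$ for $k$-center without fairness, makes $O(k)$ queries, and returns $k$ distinct centers (whenever $k\le n$) such that each $t_{i+1}$ satisfies $2\,d(t_{i+1},T_i)\ge\max_{u\in U}d(u,T_i)$. Moreover, for each constant $c$, the same conclusions (distortion at most $5$, feasibility,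 and the query bounds, with $C$ depending only on $c$) hold when the initial phase is replaced by any deterministic ordinal query procedure that, for all $k\le n$, returns $k$ distinct centers with this last property using at most $ck$ queries. -/

import Mathlib

open scoped ENNReal

/-! ## Deterministic algorithms with query access to a distance function -/

/-- A deterministic adaptive procedure that may query distances between points of `U` and
returns an element of `α`: a decision tree, where a node asks for the distance of `u` and `v`
and continues according to the answer. -/
inductive QueryM (U : Type) (α : Type) : Type
  | pure (a : α) : QueryM U α
  | query (u v : U) (next : ℝ → QueryM U α) : QueryM U α

namespace QueryM

/-- Sequential composition. -/
def bind {U α β : Type} : QueryM U α → (α → QueryM U β) → QueryM U β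
  | .pure a, f => f a
  | .query u v next, f => .query u v (fun r => bind (next r) f)

instance {U : Type} : Monad (QueryM U) where
  pure := QueryM.pure
  bind := QueryM.bind

/-- The result of the procedure when the distance function is `d`. -/
def run {U α : Type} (d : U → U → ℝ) : QueryM U α → α
  | .pure a => a
  | .query u v next => run d (next (d u v))

/-- The number of distance queries made when the distance function is `d`
(repeated queries are counted each time). -/
def count {U α : Type} (d : U → U → ℝ) : QueryM U α → ℕ
  | .pure _ => 0
  | .query u v next => count d (next (d u v)) + 1

/-- Query a single distance. -/
def ask {U : Type} (u v : U) : QueryM U ℝ := .query u v .pure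

/-- Run a procedure on every entry of a list, from left to right. -/
def traverse {U β γ : Type} (f : β → QueryM U γ) : List β → QueryM U (List γ)
  | [] => .pure []
  | b :: bs => do
      let c ← f b
      let cs ← traverse f bs
      return c :: cs

/-- Binary search for the longest prefix of a list on which the test `p` succeeds, for a list on
which the test succeeds on a prefix and fails afterwards.  The first argument bounds the number
of rounds; the length of the list always suffices. -/
def prefixSearch {U β : Type} (p : β → QueryM U Bool) : ℕ → List β → QueryM U (List β)
  | 0, _ => .pure []
  | fuel + 1, js =>
      match js.drop (js.length / 2) with
      | [] => .pure []
      | m :: rest => do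
          if ← p m then
            let r ← prefixSearch p fuel rest
            return js.take (js.length / 2) ++ m :: r
          else
            prefixSearch p fuel (js.take (js.length / 2))

end QueryM

/-! ## The ordinal fair `k`-center problem -/

/-- An ordinal profile: for every point `v` a ranking of all points, from the first
(closest to `v`) to the last. -/
abbrev Profile (U : Type) [Fintype U] : Type := U → (Fin (Fintype.card U) ≃ U)

/-- The profile is consistent with the metric: an earlier rank means no larger distance. -/
def Profile.Consistent {U : Type} [Fintype U] [MetricSpace U] (P : Profile U) : Prop :=
  ∀ (v : U) (i j : Fin (Fintype.card U)), i < j → dist (P v i) v ≤ dist (P v j) v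

/-- An instance of the ordinal fair `k`-center problem on the point set `U`.  It holds the
information that an algorithm is given; the metric is not part of it. -/
structure OrdFairInstance (U : Type) [Fintype U] where
  /-- number of centers -/
  k : ℕ
  one_le_k : 1 ≤ k
  /-- the ordinal profile -/
  pref : Profile U
  /-- number of groups -/
  t : ℕ
  /-- the groups, a partition of `U` -/
  group : Fin t → Finset U
  group_disjoint : ∀ i j, i ≠ j → Disjoint (group i) (group j)
  group_cover : ∀ u : U, ∃ i, u ∈ group i
  /-- the requirement of each group -/
  req : Fin t → ℕ

open Classical in
/-- Feasible solutions: exactly `k` centers, at least `req i` of them in group `i`. -/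
def OrdFairInstance.Feasible {U : Type} [Fintype U] (I : OrdFairInstance U) (S : Finset U) :
    Prop :=
  S.card = I.k ∧ ∀ i, I.req i ≤ (S ∩ I.group i).card

/-- The social cost of `S`: the largest distance of a point to `S` (it is `∞` for empty `S`). -/
noncomputable def socialCost {U : Type} [MetricSpace U] (S : Set U) : ℝ≥0∞ :=
  ⨆ u : U, Metric.infEDist u S

/-- Deterministic query algorithms for the ordinal fair `k`-center problem. -/
def OrdFairAlgorithm : Type 1 :=
  ∀ (U : Type) [Fintype U], OrdFairInstance U → QueryM U (Finset U)

/-- The distortion of an algorithm: the supremum, over all finite metric spaces, all profiles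
consistent with the metric and all instances that have a feasible solution, of the cost of the
computed solution divided by the optimal cost (with `0 / 0 = 0` and `x / 0 = ∞` for `x > 0`). -/
noncomputable def distortion (alg : OrdFairAlgorithm) : ℝ≥0∞ :=
  ⨆ (U : Type) (_ : Fintype U) (_ : MetricSpace U) (I : OrdFairInstance U)
    (_ : I.pref.Consistent) (_ : ∃ S, I.Feasible S),
    socialCost (((alg U I).run dist : Finset U) : Set U) /
      ⨅ (S : Finset U) (_ : I.Feasible S), socialCost (S : Set U)

/-! ## Ordinal primitives (no distance queries) -/

section Ordinal

variable {U : Type} [Fintype U]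

/-- All points, in the order of the ranking of `v`. -/
def Profile.order (P : Profile U) (v : U) : List U := List.ofFn (P v)

/-- The position of `u` in the ranking of `v`. -/
def Profile.rank (P : Profile U) (v u : U) : ℕ := ((P v).symm u : ℕ)

open Classical in
/-- The first point of `A` in the ranking of `v` (junk value `v` if `A` is empty). -/
noncomputable def Profile.nearestIn (P : Profile U) (v : U) (A : Set U) : U :=
  ((P.order v).find? (fun u => decide (u ∈ A))).getD v

open Classical in
/-- The last point of `A` in the ranking of `v` (junk value `v` if `A` is empty). -/
noncomputable def Profile.farthestIn (P : Profile U) (v : U) (A : Set U) : U :=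
  ((P.order v).reverse.find? (fun u => decide (u ∈ A))).getD v

/-- The points whose favourite among the centers `T` is `c`. -/
def Profile.cluster (P : Profile U) (T : List U) (c : U) : Set U :=
  {u | P.nearestIn u {x | x ∈ T} = c}

end Ordinal

/-! ## Initial phase: ordinal `k`-center without fairness constraints -/

/-- Query procedures that receive a profile and `k` and return a sequence of centers. -/
def InitialPhase : Type 1 :=
  ∀ (U : Type) [Fintype U], Profile U → ℕ → QueryM U (List U)

section Initial

variable {U : Type} [Fintype U]

/-- A center together with the outcome of the most recent query for it: the point `witness` that
was farthest from it in its cluster at that time, and the distance `radius` to that point. -/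
structure CenterEntry (U : Type) where
  center : U
  witness : U
  radius : ℝ

/-- Open a new center `c` and query the distance to the farthest point in its cluster. -/
noncomputable def addCenter (P : Profile U) (c : U) (es : List (CenterEntry U)) :
    QueryM U (List (CenterEntry U)) := do
  let w := P.farthestIn c (P.cluster (es.map CenterEntry.center ++ [c]) c)
  let r ← QueryM.ask c w
  return es ++ [⟨c, w, r⟩]

open Classical in
/-- Add one center.  Look at the center with the largest recorded radius.  If its recorded witness
is still the farthest point of its cluster, this point becomes the next center.  Otherwise query
the distance to the point that is farthest now; if it is at least half the recorded radius, this
point becomes the next center; if not, record the new radius and start over.  With no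
center yet, an arbitrary point is opened.  The first numerical argument bounds the number of
rounds; one more than the number of centers always suffices. -/
noncomputable def growCenters (P : Profile U) :
    ℕ → List (CenterEntry U) → QueryM U (List (CenterEntry U))
  | 0, es => .pure es
  | fuel + 1, es =>
      match es.argmax CenterEntry.radius with
      | none => if h : Nonempty U then addCenter P (Classical.choice h) [] else .pure []
      | some e =>
          let w := P.farthestIn e.center (P.cluster (es.map CenterEntry.center) e.center)
          if w = e.witness then addCenter P w es
          else do
            let r ← QueryM.ask e.center w
            let es' := es.map fun x => if x.center = e.center then ⟨e.center, w, r⟩ else x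
            if e.radius ≤ 2 * r then addCenter P w es' else growCenters P fuel es'

/-- The first `k` centers, with their records. -/
noncomputable def greedyEntries (P : Profile U) : ℕ → QueryM U (List (CenterEntry U))
  | 0 => .pure []
  | n + 1 => do
      let es ← greedyEntries P n
      growCenters P (es.length + 1) es

end Initial

/-- The ordinal farthest-first traversal with few queries. -/
noncomputable def ordinalGreedy : InitialPhase := fun U _ P k => do
  let es ← greedyEntries (U := U) P k
  return es.map CenterEntry.center

/-- `init` is an ordinal version of the farthest-first traversal: it returns `k` distinct centers,
each of which is, when it is chosen, at least half as far from the earlier centers as any other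
point, and it makes at most `c * k` distance queries. -/
def IsHalfGreedy (init : InitialPhase) (c : ℝ) : Prop :=
  ∀ (U : Type) [Fintype U] [MetricSpace U] (P : Profile U) (k : ℕ),
    P.Consistent → 1 ≤ k → k ≤ Fintype.card U →
      ((init U P k).run dist).length = k ∧
      ((init U P k).run dist).Nodup ∧
      (∀ (T T' : List U) (x : U), (init U P k).run dist = T ++ x :: T' → ∀ u : U,
        Metric.infEDist u {y | y ∈ T} ≤ 2 * Metric.infEDist x {y | y ∈ T}) ∧
      ((init U P k).count dist : ℝ) ≤ c * k

/-- `init` has distortion at most `4` for the ordinal `k`-center problem without fairness. -/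
def IsFourDistortionKCenter (init : InitialPhase) : Prop :=
  ∀ (U : Type) [Fintype U] [MetricSpace U] (P : Profile U) (k : ℕ),
    P.Consistent → 1 ≤ k → ∀ S : Finset U, S.card = k →
      socialCost {y | y ∈ (init U P k).run dist} ≤ 4 * socialCost (S : Set U)

/-! ## Reduction to `k` groups with unit requirements -/

/-- The `k` groups with unit requirement: `req i` copies of group `i`, then copies of `U`. -/
def OrdFairInstance.slotList {U : Type} [Fintype U] (I : OrdFairInstance U) : List (Finset U) :=
  ((List.finRange I.t).flatMap fun i => List.replicate (I.req i) (I.group i)) ++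
    List.replicate (I.k - ∑ i, I.req i) Finset.univ

/-- The group with index `j` among the `k` groups of the reduced instance. -/
def OrdFairInstance.slot {U : Type} [Fintype U] (I : OrdFairInstance U) (j : Fin I.k) :
    Finset U :=
  I.slotList.getD j Finset.univ

/-! ## Projection graphs

A projection graph on the centers `T` is stored as the list of the neighborhoods (lists of
groups) of the centers, in the order of `T`. -/

/-- `M` lists the partners, one for each center, in a left-perfect matching of the graph `N`. -/
def IsLeftPerfectMatching {k : ℕ} (N : List (List (Fin k))) (M : List (Fin k)) : Prop :=
  M.Nodup ∧ List.Forall₂ (fun j Nj => j ∈ Nj) M N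

section Algorithm

variable {U : Type} [Fintype U] (I : OrdFairInstance U)

/-- The point of group `j` that is closest to `s`. -/
noncomputable def OrdFairInstance.closest (s : U) (j : Fin I.k) : U :=
  I.pref.nearestIn s (I.slot j : Set U)

/-- Query the distance of `s` to group `j`. -/
noncomputable def askGroup (s : U) (j : Fin I.k) : QueryM U ℝ := QueryM.ask s (I.closest s j)

/-- All groups, sorted by their distance to `s` (using the ranking of `s` only). -/
noncomputable def groupOrder (s : U) : List (Fin I.k) :=
  (List.finRange I.k).mergeSort fun i j =>
    decide (I.pref.rank s (I.closest s i) ≤ I.pref.rank s (I.closest s j))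

/-- The maximum of a list of distances. -/
noncomputable def maxList (l : List ℝ) : ℝ := l.foldr max 0

/-- The cost of a list of centers, with one query per center. -/
noncomputable def coverCost (T : List U) : QueryM U ℝ := do
  let ds ← QueryM.traverse
    (fun s => QueryM.ask s (I.pref.farthestIn s (I.pref.cluster T s))) T
  return maxList ds

/-- The projection graph on the centers `T` with threshold `lam`, by binary search for
each center. -/
noncomputable def projectionGraph (T : List U) (lam : ℝ) : QueryM U (List (List (Fin I.k))) :=
  QueryM.traverse
    (fun s => QueryM.prefixSearch
      (fun j => do let r ← askGroup I s j; return decide (r ≤ lam)) I.k (groupOrder I s)) T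

open Classical in
/-- The predicate `4 * λ_ℓ ≤ cost T_ℓ`, evaluated as: the projection graph on `T_ℓ` with
threshold `cost T_ℓ / 4` has a left-perfect matching. -/
noncomputable def evalPredicate (T : List U) (l : ℕ) : QueryM U Bool := do
  let c ← coverCost I (T.take l)
  let N ← projectionGraph I (T.take l) (c / 4)
  return decide (∃ M, IsLeftPerfectMatching N M)

/-! ### Computing `λ_ℓ` by median of medians -/

/-- The state of the search: for each center the remaining groups (sorted by distance), the
smallest threshold known to be feasible, and the projection graph for this threshold. -/
structure SearchState (U : Type) (k : ℕ) where
  space : List (U × List (Fin k))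
  best : ℝ
  graph : List (List (Fin k))

/-- In a list of (weight, value) pairs sorted by value, the first value at which the accumulated
weight reaches half of `total`. -/
noncomputable def weightedMedian (total : ℕ) : ℕ → List (ℕ × ℝ) → ℝ
  | _, [] => 0
  | acc, (w, x) :: rest =>
      if total ≤ 2 * (acc + w) then x else weightedMedian total (acc + w) rest

/-- The pivot: the median distance of each center with nonempty remaining list is queried, and a
weighted median of these medians is returned. -/
noncomputable def pivot (D : List (U × List (Fin I.k))) : QueryM U ℝ := do
  let ms ← QueryM.traverse
    (fun x : ℕ × U × Fin I.k => do let r ← askGroup I x.2.1 x.2.2; return (x.1, r))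
    (D.filterMap fun row =>
      (row.2[row.2.length / 2]?).map fun m => (row.2.length, row.1, m))
  return weightedMedian (D.map fun row => row.2.length).sum 0
    (ms.mergeSort fun a b => decide (a.2 ≤ b.2))

open Classical in
/-- One round of the median of medians search for the centers `T`. -/
noncomputable def medianStep (T : List U) (st : SearchState U I.k) :
    QueryM U (SearchState U I.k) := do
  let tau ← pivot I st.space
  let N ← projectionGraph I T tau
  if ∃ M, IsLeftPerfectMatching N M then
    let D ← QueryM.traverse
      (fun row : U × List (Fin I.k) => do
        let q ← QueryM.prefixSearch
          (fun j => do let r ← askGroup I row.1 j; return decide (r < tau)) I.k row.2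
        return (row.1, q)) st.space
    return ⟨D, tau, N⟩
  else
    let D ← QueryM.traverse
      (fun row : U × List (Fin I.k) => do
        let q ← QueryM.prefixSearch
          (fun j => do let r ← askGroup I row.1 j; return decide (r ≤ tau)) I.k row.2
        return (row.1, row.2.drop q.length)) st.space
    return ⟨D, st.best, st.graph⟩

open Classical in
/-- Repeat until the search space is empty, for at most the given number of rounds. -/
noncomputable def medianLoop (T : List U) : ℕ → SearchState U I.k → QueryM U (SearchState U I.k)
  | 0, st => .pure st
  | n + 1, st => do
      let st' ← medianStep I T st
      if ∀ row ∈ st'.space, row.2 = [] then return st' else medianLoop T n st'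

/-- Compute, for the centers `T`, the smallest `λ` for which the projection graph has a
left-perfect matching (the field `best` of the result), together with this graph. -/
noncomputable def findLambda (T : List U) : QueryM U (SearchState U I.k) := do
  let ds ← QueryM.traverse (fun x : U × Fin I.k => askGroup I x.1 x.2)
    (T.filterMap fun s => ((groupOrder I s).getLast?).map fun j => (s, j))
  medianLoop I T (⌊Real.logb (4 / 3) (I.k * T.length)⌋₊ + 1)
    ⟨T.map fun s => (s, groupOrder I s), maxList ds, T.map (groupOrder I)⟩

/-! ### The algorithm -/

/-- Binary search on `{L, …, R}` for the largest index at which the test succeeds.  The first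
argument bounds the number of rounds. -/
def binarySearch {U : Type} (p : ℕ → QueryM U Bool) : ℕ → ℕ → ℕ → QueryM U ℕ
  | 0, L, _ => .pure L
  | fuel + 1, L, R =>
      if L < R then do
        if ← p ((L + R + 1) / 2) then binarySearch p fuel ((L + R + 1) / 2) R
        else binarySearch p fuel L ((L + R + 1) / 2 - 1)
      else .pure L

/-- The main phase: find the length of the prefix of `T` that is projected. -/
noncomputable def mainPhase (T : List U) : QueryM U ℕ := do
  if ← evalPredicate I T 1 then
    if ← evalPredicate I T I.k then return I.k
    else
      let L ← binarySearch (evalPredicate I T) I.k 1 I.k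
      let st ← findLambda I (T.take (L + 1))
      let c ← coverCost I (T.take L)
      return if c ≤ 4 * st.best then L else L + 1
  else return 1

open Classical in
/-- The points selected through a matching: for each center its closest point in the matched
group, and for each unmatched group an arbitrary point of that group. -/
noncomputable def projectedSet (T : List U) (M : List (Fin I.k)) : Finset U :=
  (List.zipWith (fun s j => I.closest s j) T M).toFinset ∪
    (Finset.univ.filter fun j : Fin I.k => j ∉ M).biUnion fun j =>
      if h : (I.slot j).Nonempty then {h.choose} else ∅

open Classical in
/-- Supplement a set of points with arbitrary points to a feasible solution, where possible. -/
noncomputable def supplement (S : Finset U) : Finset U :=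
  if h : ∃ S', S ⊆ S' ∧ I.Feasible S' then h.choose else S

open Classical in
/-- The final phase: project the centers `T` along a left-perfect matching of the projection
graph `N`. -/
noncomputable def finalSolution (T : List U) (N : List (List (Fin I.k))) : Finset U :=
  supplement I (projectedSet I T (if h : ∃ M, IsLeftPerfectMatching N M then h.choose else []))

end Algorithm

/-- The algorithm for the ordinal fair `k`-center problem, with a given initial phase. -/
noncomputable def ordFairKCenter (init : InitialPhase) : OrdFairAlgorithm := fun U _ I => do
  let T ← init U I.pref I.k
  let l ← mainPhase I T
  let st ← findLambda I (T.take l)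
  return finalSolution I (T.take l) st.graph

/-- The algorithm solves the ordinal fair `k`-center problem: on every instance that has a
feasible solution it returns one, with at most `C * k * (log k)^2` distance queries
(at most `C` for `k = 1`), and its distortion is at most `5`. -/
def SolvesWithFiveDistortion (alg : OrdFairAlgorithm) (C : ℝ) : Prop :=
  (∀ (U : Type) [Fintype U] [MetricSpace U] (I : OrdFairInstance U),
    I.pref.Consistent → (∃ S, I.Feasible S) →
      I.Feasible ((alg U I).run dist) ∧
      (2 ≤ I.k → ((alg U I).count dist : ℝ) ≤ C * (I.k * Real.logb 2 I.k ^ 2)) ∧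
      (I.k = 1 → ((alg U I).count dist : ℝ) ≤ C)) ∧
  distortion alg ≤ 5

/-!
The algorithm is a traversal followed by a projection of a prefix of its centers to the groups.
Three arguments carry the theorem.

*Queries of the initial phase.*  All recorded radii are bounded by the current maximum `B`, which
bounds the cost of the centers, and a new center is at distance at least `B / 2` from the others.
A round that opens no center more than halves a recorded radius.  These rounds are paid by credits
(`Affordable`): a center `c` with recorded radius `ρ` holds a credit of about `log (4 ρ / δ)`, where
`δ` is its distance to the nearest other center, the distances to centers opened before `c` being
divided by `16`.  If such a round happens at `c`, the recorded witness has moved to another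
center, which lies within `2 ρ` of `c`, so the credit is positive, and halving `ρ` sets one unit
free.  When a center `w` is opened, at most one earlier center needs more credit
(`addCenter_spec`): two of them would both be so close to `w` that the later one would have been
too close to the earlier one when it was opened.  So a constant number of units per opened center
suffices (`growCenters_spec`, `greedyEntries_spec`).

*Distortion.*  Let `o` be the cost of a feasible set `S`.  If two of the first `l` centers are within
`2 o` of each other, the half-greedy property gives `cost T_(l-1) ≤ 4 o`; otherwise these centers have
distinct nearest points in `S`, and since `S` is a transversal of the `k` groups with unit
requirement (`exists_transversal`), they can be projected with threshold `o`, that is,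
`λ_l ≤ o` (`matchable_or_cover`).  The selected prefix costs at most `cost T_l + λ_l`, and in each case
of the main phase this dichotomy bounds the sum by `5 o` (`mainPhase_spec`).  With `k` centers
the first alternative or the pigeonhole principle gives `cost T_k ≤ 4 o`, which is also the
distortion of the initial phase (`HalfGreedyList.cover_of_card_le`).  Representatives of the `k`
groups extend to a feasible set even if they coincide, because the number of representatives
counted with multiplicity in group `i` is at least its requirement, and these numbers add up to `k`
(`exists_feasible_superset`).

*Queries of the other phases.*  In the search for `λ_l`, at least half of the candidates belong to
centers whose median lies on the discarded side of the weighted median, and at least half of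
the candidates of each of these are discarded.  So every round removes a quarter of the candidates
(`medianStep_spec`), and `O(log k)` rounds with `O(k log k)` queries each suffice
(`findLambda_spec`).  The main phase makes `O(log k)` evaluations of its predicate, each with
`O(k log k)` queries.
-/

/-! ### Running and counting query procedures -/

namespace QueryM

variable {U α β γ : Type} (d : U → U → ℝ)

@[simp] theorem run_pure (a : α) : (Pure.pure a : QueryM U α).run d = a := rfl

@[simp] theorem run_pure' (a : α) : (QueryM.pure a : QueryM U α).run d = a := rfl

@[simp] theorem count_pure (a : α) : (Pure.pure a : QueryM U α).count d = 0 := rfl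

@[simp] theorem count_pure' (a : α) : (QueryM.pure a : QueryM U α).count d = 0 := rfl

@[simp] theorem run_bind (x : QueryM U α) (f : α → QueryM U β) :
    (x >>= f).run d = (f (x.run d)).run d := by
  change (QueryM.bind x f).run d = _
  induction x with
  | pure a => rfl
  | query u v next ih => exact ih _

@[simp] theorem count_bind (x : QueryM U α) (f : α → QueryM U β) :
    (x >>= f).count d = x.count d + (f (x.run d)).count d := by
  change (QueryM.bind x f).count d = _
  induction x with
  | pure a => simp [QueryM.bind, run]
  | query u v next ih =>
    simp only [QueryM.bind, count, run, ih]
    omega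

@[simp] theorem run_ask (u v : U) : (ask u v).run d = d u v := rfl

@[simp] theorem count_ask (u v : U) : (ask u v).count d = 1 := rfl

@[simp] theorem run_traverse (f : β → QueryM U γ) (l : List β) :
    (traverse f l).run d = l.map fun b => (f b).run d := by
  induction l with
  | nil => rfl
  | cons b bs ih => simp [traverse, ih]

theorem count_traverse_le (f : β → QueryM U γ) (l : List β) (n : ℕ)
    (h : ∀ b ∈ l, (f b).count d ≤ n) : (traverse f l).count d ≤ l.length * n := by
  induction l with
  | nil => simp [traverse]
  | cons b bs ih =>
    have h1 := h b (by simp)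
    have h2 := ih fun b' hb' => h b' (by simp [hb'])
    simp only [traverse, count_bind, count_pure, List.length_cons, add_mul, one_mul]
    omega

open Classical in
/-- On a list on which the test succeeds on a prefix and fails afterwards, binary search returns
exactly the entries that pass the test. -/
theorem run_prefixSearch (p : β → QueryM U Bool) (Q : β → Prop) (fuel : ℕ) (js : List β)
    (hp : ∀ j ∈ js, ((p j).run d = true ↔ Q j)) (hs : js.Pairwise fun i j => Q j → Q i)
    (hf : js.length ≤ fuel) :
    (prefixSearch p fuel js).run d = js.filter fun j => decide (Q j) := by
  induction fuel generalizing js with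
  | zero =>
    have : js = [] := List.eq_nil_of_length_eq_zero (by omega)
    subst this; rfl
  | succ fuel ih =>
    rw [prefixSearch]
    have hsplit := List.take_append_drop (js.length / 2) js
    split
    · rename_i h
      have h0 : js.length ≤ js.length / 2 := List.drop_eq_nil_iff.1 h
      have : js = [] := List.eq_nil_of_length_eq_zero (by omega)
      subst this; rfl
    · rename_i m rest h
      rw [h] at hsplit
      generalize hA : js.take (js.length / 2) = A at hsplit
      have hlenA : A.length = js.length / 2 := by
        rw [← hA, List.length_take]; omega
      have hlen : A.length + (rest.length + 1) = js.length := by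
        rw [← hsplit]; simp
      have hs' : (A ++ m :: rest).Pairwise fun i j => Q j → Q i := hsplit ▸ hs
      rw [List.pairwise_append, List.pairwise_cons] at hs'
      obtain ⟨hsA, ⟨hsm, hsr⟩, hsAr⟩ := hs'
      have hpm : ((p m).run d = true ↔ Q m) := hp m (by rw [← hsplit]; simp)
      simp only [run_bind]
      by_cases hm : Q m
      · rw [if_pos (hpm.2 hm)]
        have hAf : A.filter (fun j => decide (Q j)) = A :=
          List.filter_eq_self.2 fun a ha => by simpa using hsAr a ha m (by simp) hm
        rw [run_bind, run_pure, ih rest (fun j hj => hp j (by rw [← hsplit]; simp [hj])) hsr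
          (by omega)]
        conv_rhs => rw [← hsplit]
        rw [List.filter_append, List.filter_cons_of_pos (by simpa using hm), hAf]
      · rw [if_neg (fun h' => hm (hpm.1 h')),
          ih A (fun j hj => hp j (by rw [← hsplit]; simp [hj])) hsA (by omega)]
        conv_rhs => rw [← hsplit]
        have : rest.filter (fun j => decide (Q j)) = [] :=
          List.filter_eq_nil_iff.2 fun a ha => by simpa using fun h' => hm (hsm a ha h')
        rw [List.filter_append, List.filter_cons_of_neg (by simpa using hm), this,
          List.append_nil]

theorem size_half {n : ℕ} (h : n ≠ 0) : Nat.size n = Nat.size (n / 2) + 1 := by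
  conv_lhs => rw [← Nat.bit_bodd_div2 n]
  rw [Nat.size_bit (by rwa [Nat.bit_bodd_div2]), Nat.div2_val]

theorem count_prefixSearch_le (p : β → QueryM U Bool) (hp : ∀ j, (p j).count d ≤ 1)
    (fuel : ℕ) (js : List β) : (prefixSearch p fuel js).count d ≤ Nat.size js.length := by
  induction fuel generalizing js with
  | zero => simp [prefixSearch]
  | succ fuel ih =>
    rw [prefixSearch]
    split
    · simp
    · rename_i m rest h
      have hl : (js.drop (js.length / 2)).length = rest.length + 1 := by rw [h]; simp
      rw [List.length_drop] at hl
      have h0 : js.length ≠ 0 := by omega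
      have hm := hp m
      rw [size_half h0]
      rw [count_bind]
      split
      · have := ih rest
        have hle : Nat.size rest.length ≤ Nat.size (js.length / 2) :=
          Nat.size_le_size (by omega)
        simp only [count_bind, count_pure]
        omega
      · have := ih (js.take (js.length / 2))
        have hle : Nat.size (js.take (js.length / 2)).length ≤ Nat.size (js.length / 2) :=
          Nat.size_le_size (by rw [List.length_take]; omega)
        omega

end QueryM

/-- Binary search between an index where a predicate holds and one where it fails finds an
index where it holds followed by one where it fails. -/
theorem run_binarySearch {U : Type} (d : U → U → ℝ) (p : ℕ → QueryM U Bool) (fuel L R : ℕ)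
    (hLR : L ≤ R) (hf : R - L ≤ fuel) (hL : (p L).run d = true) :
    L ≤ (binarySearch p fuel L R).run d ∧ (binarySearch p fuel L R).run d ≤ R ∧
      (p ((binarySearch p fuel L R).run d)).run d = true ∧
      ((binarySearch p fuel L R).run d < R →
        (p ((binarySearch p fuel L R).run d + 1)).run d = false) := by
  induction fuel generalizing L R with
  | zero =>
    simp only [binarySearch, QueryM.run_pure']
    exact ⟨le_rfl, hLR, hL, by omega⟩
  | succ fuel ih =>
    rw [binarySearch]
    split
    · rename_i hlt
      simp only [QueryM.run_bind]
      split
      · rename_i hm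
        obtain ⟨h1, h2, h3, h4⟩ := ih ((L + R + 1) / 2) R (by omega) (by omega) hm
        exact ⟨by omega, h2, h3, h4⟩
      · rename_i hm
        obtain ⟨h1, h2, h3, h4⟩ := ih L ((L + R + 1) / 2 - 1) (by omega) (by omega) hL
        refine ⟨h1, by omega, h3, fun _ => ?_⟩
        rcases h2.lt_or_eq with h2 | h2
        · exact h4 h2
        · rw [h2, show (L + R + 1) / 2 - 1 + 1 = (L + R + 1) / 2 by omega]
          simpa using hm
    · simp only [QueryM.run_pure']
      exact ⟨le_rfl, hLR, hL, by omega⟩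

theorem count_binarySearch_le {U : Type} (d : U → U → ℝ) (p : ℕ → QueryM U Bool) (n R₀ : ℕ)
    (hp : ∀ l ≤ R₀, (p l).count d ≤ n) (fuel L R : ℕ) (hR : R ≤ R₀) :
    (binarySearch p fuel L R).count d ≤ Nat.size (R - L) * n := by
  induction fuel generalizing L R with
  | zero => simp [binarySearch]
  | succ fuel ih =>
    rw [binarySearch]
    split
    · rename_i hlt
      rw [QueryM.count_bind, QueryM.size_half (by omega), add_mul, one_mul]
      have h0 := hp ((L + R + 1) / 2) (by omega)
      split
      · have h1 := ih ((L + R + 1) / 2) R hR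
        have h2 : Nat.size (R - (L + R + 1) / 2) * n ≤ Nat.size ((R - L) / 2) * n :=
          Nat.mul_le_mul_right _ (Nat.size_le_size (by omega))
        omega
      · have h1 := ih L ((L + R + 1) / 2 - 1) (by omega)
        have h2 : Nat.size ((L + R + 1) / 2 - 1 - L) * n ≤ Nat.size ((R - L) / 2) * n :=
          Nat.mul_le_mul_right _ (Nat.size_le_size (by omega))
        omega
    · simp

/-! ### Ordinal primitives and the metric -/

section OrdinalMetric

variable {U : Type} [Fintype U] {P : Profile U}

theorem Profile.mem_order (v u : U) : u ∈ P.order v := by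
  rw [Profile.order, List.mem_ofFn]
  exact ⟨(P v).symm u, by simp⟩

theorem Profile.order_pairwise (v : U) :
    (P.order v).Pairwise fun a b => P.rank v a < P.rank v b := by
  rw [Profile.order, List.pairwise_ofFn]
  intro i j hij
  simpa [Profile.rank] using hij

theorem Profile.nearestIn_spec (v : U) {A : Set U} (hA : A.Nonempty) :
    P.nearestIn v A ∈ A ∧ ∀ u ∈ A, P.rank v (P.nearestIn v A) ≤ P.rank v u := by
  classical
  obtain ⟨a, ha⟩ := hA
  unfold Profile.nearestIn
  cases h : (P.order v).find? (fun u => decide (u ∈ A)) with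
  | none =>
    rw [List.find?_eq_none] at h
    exact absurd ha (by simpa using h a (Profile.mem_order v a))
  | some b =>
    rw [List.find?_eq_some_iff_append] at h
    obtain ⟨hb, as, bs, hl, has⟩ := h
    refine ⟨by simpa using hb, fun u hu => ?_⟩
    have hm := Profile.mem_order (P := P) v u
    have hp := Profile.order_pairwise (P := P) v
    rw [hl] at hm hp
    rw [List.pairwise_append, List.pairwise_cons] at hp
    simp only [List.mem_append, List.mem_cons] at hm
    rcases hm with hm | rfl | hm
    · exact absurd hu (by simpa using has u hm)
    · exact le_rfl
    · exact (hp.2.1.1 u hm).le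

theorem Profile.farthestIn_spec (v : U) {A : Set U} (hA : A.Nonempty) :
    P.farthestIn v A ∈ A ∧ ∀ u ∈ A, P.rank v u ≤ P.rank v (P.farthestIn v A) := by
  classical
  obtain ⟨a, ha⟩ := hA
  unfold Profile.farthestIn
  cases h : (P.order v).reverse.find? (fun u => decide (u ∈ A)) with
  | none =>
    rw [List.find?_eq_none] at h
    exact absurd ha (by simpa using h a (by simpa using Profile.mem_order v a))
  | some b =>
    rw [List.find?_eq_some_iff_append] at h
    obtain ⟨hb, as, bs, hl, has⟩ := h
    refine ⟨by simpa using hb, fun u hu => ?_⟩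
    have hm : u ∈ (P.order v).reverse := by simpa using Profile.mem_order v u
    have hp : (P.order v).reverse.Pairwise fun a b => P.rank v b < P.rank v a :=
      List.pairwise_reverse.2 (Profile.order_pairwise (P := P) v)
    rw [hl] at hm hp
    rw [List.pairwise_append, List.pairwise_cons] at hp
    simp only [List.mem_append, List.mem_cons] at hm
    rcases hm with hm | rfl | hm
    · exact absurd hu (by simpa using has u hm)
    · exact le_rfl
    · exact (hp.2.1.1 u hm).le

/-- Every point lies in the cluster of one of the centers. -/
theorem Profile.exists_mem_cluster (P : Profile U) {T : List U} (hT : T ≠ []) (u : U) :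
    ∃ c ∈ T, u ∈ P.cluster T c :=
  ⟨P.nearestIn u {x | x ∈ T},
    (Profile.nearestIn_spec (A := {x | x ∈ T}) u ⟨T.head hT, List.head_mem hT⟩).1, rfl⟩

variable [MetricSpace U]

theorem Profile.Consistent.dist_le (hP : P.Consistent) {v a b : U}
    (h : P.rank v a ≤ P.rank v b) : dist v a ≤ dist v b := by
  rcases h.lt_or_eq with h | h
  · have := hP v ((P v).symm a) ((P v).symm b) h
    simpa [dist_comm] using this
  · have : a = b := (P v).symm.injective (Fin.ext h)
    rw [this]

theorem Profile.Consistent.dist_nearestIn_le (hP : P.Consistent) (v : U) {A : Set U} {u : U}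
    (hu : u ∈ A) : dist v (P.nearestIn v A) ≤ dist v u :=
  hP.dist_le ((Profile.nearestIn_spec v ⟨u, hu⟩).2 u hu)

theorem Profile.Consistent.dist_le_farthestIn (hP : P.Consistent) (v : U) {A : Set U} {u : U}
    (hu : u ∈ A) : dist v u ≤ dist v (P.farthestIn v A) :=
  hP.dist_le ((Profile.farthestIn_spec v ⟨u, hu⟩).2 u hu)

theorem Profile.Consistent.nearestIn_self (hP : P.Consistent) {v : U} {A : Set U}
    (hv : v ∈ A) : P.nearestIn v A = v := by
  have := hP.dist_nearestIn_le v hv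
  rw [dist_self] at this
  exact (dist_le_zero.1 this).symm

/-- In its cluster a center is a closest center. -/
theorem Profile.Consistent.dist_cluster_le (hP : P.Consistent) {T : List U} {c c' u : U}
    (hu : u ∈ P.cluster T c) (hc' : c' ∈ T) : dist u c ≤ dist u c' := by
  have h : P.nearestIn u {x | x ∈ T} = c := hu
  rw [← h]
  exact hP.dist_nearestIn_le u hc'

theorem Profile.Consistent.self_mem_cluster (hP : P.Consistent) {T : List U} {c : U}
    (hc : c ∈ T) : c ∈ P.cluster T c :=
  hP.nearestIn_self (A := {x | x ∈ T}) hc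

end OrdinalMetric

/-! ### Distances to finite sets of centers -/

section InfEDist

variable {U : Type} [MetricSpace U]

theorem exists_infEDist_eq_of_list {T : List U} (hT : T ≠ []) (u : U) :
    ∃ s ∈ T, Metric.infEDist u {y | y ∈ T} = edist u s := by
  have hc : IsCompact {y | y ∈ T} := (List.finite_toSet T).isCompact
  exact hc.exists_infEDist_eq_edist ⟨T.head hT, List.head_mem hT⟩ u

theorem infEDist_le_two_mul_iff {T : List U} (hT : T ≠ []) (u x : U) :
    Metric.infEDist u {y | y ∈ T} ≤ 2 * Metric.infEDist x {y | y ∈ T} ↔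
      ∀ y ∈ T, ∃ s ∈ T, dist u s ≤ 2 * dist x y := by
  have key : ∀ a b : ℝ, 0 ≤ b → (ENNReal.ofReal a ≤ 2 * ENNReal.ofReal b ↔ a ≤ 2 * b) := by
    intro a b hb
    rw [show (2 : ℝ≥0∞) = ENNReal.ofReal 2 by simp, ← ENNReal.ofReal_mul (by norm_num),
      ENNReal.ofReal_le_ofReal_iff (by positivity)]
  obtain ⟨s, hs, hs'⟩ := exists_infEDist_eq_of_list hT u
  obtain ⟨y, hy, hy'⟩ := exists_infEDist_eq_of_list hT x
  constructor
  · intro h z hz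
    refine ⟨s, hs, ?_⟩
    rw [← key _ _ dist_nonneg, ← edist_dist, ← edist_dist, ← hs']
    exact h.trans (mul_le_mul_right (Metric.infEDist_le_edist_of_mem (s := {y | y ∈ T}) hz) _)
  · intro h
    obtain ⟨s', hs2, h2⟩ := h y hy
    rw [hy']
    refine (Metric.infEDist_le_edist_of_mem (s := {y | y ∈ T}) hs2).trans ?_
    rw [edist_dist, edist_dist, key _ _ dist_nonneg]
    exact h2

theorem socialCost_le_ofReal {S : Set U} {c : ℝ} (h : ∀ u, ∃ s ∈ S, dist u s ≤ c) :
    socialCost S ≤ ENNReal.ofReal c := by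
  refine iSup_le fun u => ?_
  obtain ⟨s, hs, hsc⟩ := h u
  refine (Metric.infEDist_le_edist_of_mem hs).trans ?_
  rw [edist_dist]
  exact ENNReal.ofReal_le_ofReal hsc

theorem exists_socialCost_eq_ofReal [Fintype U] {S : Finset U} (hS : S.Nonempty) :
    ∃ o : ℝ, 0 ≤ o ∧ socialCost (S : Set U) = ENNReal.ofReal o ∧
      ∀ u, ∃ s ∈ S, dist u s ≤ o := by
  have hex : ∀ u, ∃ s ∈ (S : Set U), Metric.infEDist u (S : Set U) = edist u s := fun u =>
    S.finite_toSet.isCompact.exists_infEDist_eq_edist (by simpa using hS) u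
  have htop : socialCost (S : Set U) ≠ ⊤ := by
    have : Nonempty U := ⟨hS.choose⟩
    obtain ⟨u, hu⟩ := Finite.exists_max fun u : U => Metric.infEDist u (S : Set U)
    obtain ⟨s, _, hs⟩ := hex u
    refine ne_top_of_le_ne_top (b := edist u s) (edist_ne_top _ _) (iSup_le fun v => ?_)
    rw [← hs]; exact hu v
  refine ⟨(socialCost (S : Set U)).toReal, ENNReal.toReal_nonneg,
    (ENNReal.ofReal_toReal htop).symm, fun u => ?_⟩
  obtain ⟨s, hs, hs'⟩ := hex u
  refine ⟨s, by simpa using hs, ?_⟩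
  have h1 : edist u s ≤ socialCost (S : Set U) := by
    rw [← hs']; exact le_iSup (fun u : U => Metric.infEDist u (S : Set U)) u
  rw [edist_dist] at h1
  exact (ENNReal.ofReal_le_iff_le_toReal htop).1 h1

end InfEDist

/-! ### The ordinal farthest-first traversal -/

namespace List

theorem Pairwise.forall_or_exists_unique {α : Type*} {R : α → α → Prop} {q : α → Prop}
    {l : List α} (hl : l.Pairwise R) (h : ∀ a ∈ l, ∀ b ∈ l, R a b → q a ∨ q b) :
    (∀ a ∈ l, q a) ∨ ∃ m ∈ l, ∀ a ∈ l, a ≠ m → q a := by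
  induction l with
  | nil => exact Or.inl (by simp)
  | cons x l ih =>
    rw [pairwise_cons] at hl
    by_cases hx : q x
    · rcases ih hl.2 fun a ha b hb =>
        h a (mem_cons_of_mem _ ha) b (mem_cons_of_mem _ hb) with h' | ⟨m, hm, h'⟩
      · exact Or.inl (by simpa [hx] using h')
      · refine Or.inr ⟨m, mem_cons_of_mem _ hm, fun a ha hne => ?_⟩
        rcases mem_cons.1 ha with rfl | ha
        · exact hx
        · exact h' a ha hne
    · refine Or.inr ⟨x, by simp, fun a ha hne => ?_⟩
      rcases mem_cons.1 ha with rfl | ha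
      · exact absurd rfl hne
      · exact (h x (by simp) a (mem_cons_of_mem _ ha) (hl.1 a ha)).resolve_left hx

theorem countP_map_lt {α : Type*} (q : α → Bool) (f : α → α) (l : List α)
    (h : ∀ x ∈ l, q (f x) = true → q x = true)
    (he : ∃ e ∈ l, q e = true ∧ q (f e) = false) : (l.map f).countP q < l.countP q := by
  induction l with
  | nil => simp at he
  | cons x l ih =>
    have hle : (l.map f).countP q ≤ l.countP q := by
      rw [countP_map]
      exact countP_mono_left fun y hy => h y (mem_cons_of_mem _ hy)
    have hx := h x (by simp)
    rw [map_cons, countP_cons, countP_cons]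
    obtain ⟨e, hel, h1, h2⟩ := he
    rcases mem_cons.1 hel with rfl | hel
    · simp only [h1, h2, if_true, Bool.false_eq_true, if_false]
      omega
    · have := ih (fun y hy => h y (mem_cons_of_mem _ hy)) ⟨e, hel, h1, h2⟩
      split <;> split <;> simp_all

theorem sum_map_update_sub_one {α : Type*} [DecidableEq α] (a : α → ℕ) {e : α} (he : 1 ≤ a e)
    (l : List α) (h : e ∈ l) :
    (l.map (Function.update a e (a e - 1))).sum + 1 ≤ (l.map a).sum := by
  have hle : ∀ x, Function.update a e (a e - 1) x ≤ a x := by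
    intro x
    rcases eq_or_ne x e with rfl | hx
    · simp
    · simp [hx]
  obtain ⟨s, t, rfl⟩ := append_of_mem h
  have h1 := sum_le_sum (l := s) fun x _ => hle x
  have h2 := sum_le_sum (l := t) fun x _ => hle x
  simp only [map_append, map_cons, sum_append, sum_cons, Function.update_self]
  omega

theorem sum_map_update_add_three {α : Type*} [DecidableEq α] (a : α → ℕ) (e : α)
    (l : List α) (h : l.Nodup) :
    (l.map (Function.update a e (a e + 3))).sum ≤ (l.map a).sum + 3 := by
  induction l with
  | nil => simp
  | cons x l ih =>
    rw [nodup_cons] at h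
    simp only [map_cons, sum_cons]
    rcases eq_or_ne x e with rfl | hx
    · have : l.map (Function.update a x (a x + 3)) = l.map a :=
        map_congr_left fun y hy => by
          rw [Function.update_of_ne]; rintro rfl; exact h.1 hy
      rw [this, Function.update_self]
      omega
    · have := ih h.2
      rw [Function.update_of_ne hx]
      omega

end List

section Greedy

variable {U : Type} [Fintype U] {P : Profile U}

theorem Profile.cluster_append_subset {T : List U} {c x : U} (hc : c ∈ T) :
    P.cluster (T ++ [x]) c ⊆ P.cluster T c := by
  intro u hu
  have hu : P.nearestIn u {y | y ∈ T ++ [x]} = c := hu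
  have hT : ({y | y ∈ T} : Set U).Nonempty := ⟨c, hc⟩
  have h1 := Profile.nearestIn_spec (P := P) (A := {y | y ∈ T}) u hT
  have h2 := Profile.nearestIn_spec (P := P) (A := {y | y ∈ T ++ [x]}) u
    ⟨c, by simp [hc]⟩
  rw [hu] at h2
  refine (P u).symm.injective (Fin.ext (le_antisymm (h1.2 c hc) (h2.2 _ ?_)))
  have := h1.1
  simp only [Set.mem_ofPred_eq, List.mem_append] at this ⊢
  exact Or.inl this

/-- Replace the record of the center of `e`. -/
noncomputable abbrev CenterEntry.refresh (e : CenterEntry U) (w : U) (r : ℝ)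
    (x : CenterEntry U) : CenterEntry U := by
  classical exact if x.center = e.center then ⟨e.center, w, r⟩ else x

omit [Fintype U] in
theorem CenterEntry.refresh_center (e : CenterEntry U) (w : U) (r : ℝ) (x : CenterEntry U) :
    (e.refresh w r x).center = x.center := by
  unfold CenterEntry.refresh
  split
  · rename_i h; exact h.symm
  · rfl

omit [Fintype U] in
theorem CenterEntry.map_refresh_center (e : CenterEntry U) (w : U) (r : ℝ)
    (es : List (CenterEntry U)) :
    (es.map (e.refresh w r)).map CenterEntry.center = es.map CenterEntry.center := by
  rw [List.map_map]
  exact List.map_congr_left fun x _ => e.refresh_center w r x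

variable [MetricSpace U]

/-- Each center of the list is, up to a factor of two, a point farthest from the earlier ones. -/
def HalfGreedyList (T : List U) : Prop :=
  ∀ (A B : List U) (x : U), T = A ++ x :: B → ∀ u : U, ∀ y ∈ A, ∃ s ∈ A, dist u s ≤ 2 * dist x y

/-- What holds for the records at any time: a recorded radius is the distance to the recorded
witness and bounds the radius of the cluster, and a witness that has not left the cluster is
still its last point. -/
structure GoodEntries (P : Profile U) (es : List (CenterEntry U)) : Prop where
  nodup : (es.map CenterEntry.center).Nodup
  radius_eq : ∀ e ∈ es, e.radius = dist e.center e.witness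
  le_radius : ∀ e ∈ es, ∀ u ∈ P.cluster (es.map CenterEntry.center) e.center,
    dist e.center u ≤ e.radius
  witness_eq : ∀ e ∈ es, e.witness ∈ P.cluster (es.map CenterEntry.center) e.center →
    P.farthestIn e.center (P.cluster (es.map CenterEntry.center) e.center) = e.witness
  greedy : HalfGreedyList (es.map CenterEntry.center)

/-- The credit `a c` of a center `c` with recorded radius `ρ` pays for `log (4 ρ / δ)` halvings of
`ρ`, where `δ` is the smallest distance from `c` to another center; the distance to a center that
was opened before `c` is divided by `16` here. -/
def Affordable (a : U → ℕ) (es : List (CenterEntry U)) : Prop :=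
  es.Pairwise fun e f =>
    4 * e.radius ≤ 2 ^ a e.center * dist e.center f.center ∧
    64 * f.radius ≤ 2 ^ a f.center * dist e.center f.center

theorem GoodEntries.refresh {es : List (CenterEntry U)} (hP : P.Consistent)
    (h : GoodEntries P es) {e : CenterEntry U} (he : e ∈ es) {w : U} (hw : w = P.farthestIn e.center
      (P.cluster (es.map CenterEntry.center) e.center)) :
    GoodEntries P (es.map (e.refresh w (dist e.center w))) := by
  have hmem : e.center ∈ es.map CenterEntry.center := List.mem_map_of_mem he
  refine ⟨?_, ?_, ?_, ?_, ?_⟩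
  · rw [e.map_refresh_center]; exact h.nodup
  · intro x hx
    obtain ⟨y, hy, rfl⟩ := List.mem_map.1 hx
    unfold CenterEntry.refresh
    split
    · rfl
    · exact h.radius_eq y hy
  · intro x hx u
    rw [e.map_refresh_center]
    obtain ⟨y, hy, rfl⟩ := List.mem_map.1 hx
    unfold CenterEntry.refresh
    split
    · intro hu
      simp only [hw]
      exact hP.dist_le_farthestIn _ hu
    · exact h.le_radius y hy u
  · intro x hx
    rw [e.map_refresh_center]
    obtain ⟨y, hy, rfl⟩ := List.mem_map.1 hx
    unfold CenterEntry.refresh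
    split
    · intro _; exact hw.symm
    · exact h.witness_eq y hy
  · rw [e.map_refresh_center]; exact h.greedy

omit [Fintype U] in
theorem Affordable.refresh {a a' : U → ℕ} {es : List (CenterEntry U)} (h : Affordable a es)
    {e : CenterEntry U} {w : U} {r : ℝ}
    (hx : ∀ x ∈ es, ∀ D : ℝ, 0 ≤ D →
      (4 * x.radius ≤ 2 ^ a x.center * D →
        4 * (e.refresh w r x).radius ≤ 2 ^ a' x.center * D)) :
    Affordable a' (es.map (e.refresh w r)) := by
  unfold Affordable
  rw [List.pairwise_map]
  refine List.Pairwise.imp_of_mem ?_ h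
  intro x y hx' hy' hxy
  rw [e.refresh_center, e.refresh_center]
  have h2 := hx y hy' (dist x.center y.center / 16) (by positivity)
    (by linarith [hxy.2])
  exact ⟨hx x hx' _ dist_nonneg hxy.1, by linarith⟩

/-- Opening a center `w` that is at least `B / 2` away from all centers, where `B` bounds the
recorded radii.  At most one earlier center needs more credit: two of them would both
be so close to `w` that the later one was too close to the other when it was opened. -/
theorem addCenter_spec {es : List (CenterEntry U)} (hP : P.Consistent) (h : GoodEntries P es)
    (hne : es ≠ []) {B : ℝ} (hB : ∀ e ∈ es, e.radius ≤ B) (hB0 : 0 < B) {w : U}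
    (hw : ∀ e ∈ es, B ≤ 2 * dist e.center w) {a : U → ℕ} (ha : Affordable a es) :
    GoodEntries P ((addCenter P w es).run dist) ∧
      ((addCenter P w es).run dist).length = es.length + 1 ∧
      (addCenter P w es).count dist = 1 ∧
      ∃ a' : U → ℕ, Affordable a' ((addCenter P w es).run dist) ∧
        ((((addCenter P w es).run dist).map CenterEntry.center).map a').sum ≤
          ((es.map CenterEntry.center).map a).sum + 10 := by
  classical
  set T := es.map CenterEntry.center with hT
  set v := P.farthestIn w (P.cluster (T ++ [w]) w) with hv
  have hTne : T ≠ [] := by simpa [hT] using hne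
  have hrun : (addCenter P w es).run dist = es ++ [⟨w, v, dist w v⟩] := by
    simp [addCenter, hv, hT]
  have hcount : (addCenter P w es).count dist = 1 := by
    simp [addCenter]
  have hwT : w ∉ T := by
    intro hmem
    obtain ⟨e, he, hew⟩ := List.mem_map.1 hmem
    have := hw e he
    rw [hew, dist_self] at this
    linarith
  have hnear : ∀ u, ∃ e ∈ es, dist e.center u ≤ B := by
    intro u
    obtain ⟨c, hc, hu⟩ := P.exists_mem_cluster hTne u
    obtain ⟨e, he, rfl⟩ := List.mem_map.1 hc
    exact ⟨e, he, (h.le_radius e he u hu).trans (hB e he)⟩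
  have hmap : (es ++ [(⟨w, v, dist w v⟩ : CenterEntry U)]).map CenterEntry.center = T ++ [w] := by
    simp [hT]
  have hwself : w ∈ P.cluster (T ++ [w]) w := hP.self_mem_cluster (by simp)
  have hvB : dist w v ≤ B := by
    have hvm := (Profile.farthestIn_spec (P := P) w ⟨w, hwself⟩).1
    rw [← hv] at hvm
    obtain ⟨e, he, hev⟩ := hnear v
    have h1 := hP.dist_cluster_le hvm (c' := e.center)
      (List.mem_append_left _ (List.mem_map_of_mem he))
    rw [dist_comm w v]
    rw [dist_comm e.center v] at hev
    exact h1.trans hev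
  rw [hrun, hmap]
  refine ⟨⟨?_, ?_, ?_, ?_, ?_⟩, by simp, hcount, ?_⟩
  · rw [hmap]
    exact List.nodup_append.2 ⟨h.nodup, by simp, by
      intro x hx y hy hxy
      rw [List.mem_singleton] at hy
      exact hwT (hy ▸ hxy ▸ hx)⟩
  · intro e he
    rcases List.mem_append.1 he with he | he
    · exact h.radius_eq e he
    · rw [List.mem_singleton] at he
      subst he; rfl
  · intro e he u
    rw [hmap]
    rcases List.mem_append.1 he with he | he
    · exact fun hu => h.le_radius e he u
        (Profile.cluster_append_subset (List.mem_map_of_mem he) hu)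
    · rw [List.mem_singleton] at he
      subst he
      exact fun hu => hP.dist_le_farthestIn _ hu
  · intro e he
    rw [hmap]
    rcases List.mem_append.1 he with he | he
    · intro hm
      have hmemT : e.center ∈ T := List.mem_map_of_mem he
      have hsub := Profile.cluster_append_subset (P := P) (x := w) hmemT
      have hold := h.witness_eq e he (hsub hm)
      have hnew := Profile.farthestIn_spec (P := P) e.center ⟨e.witness, hm⟩
      have h1 := (Profile.farthestIn_spec (P := P) e.center ⟨e.witness, hsub hm⟩).2 _ (hsub hnew.1)
      rw [← hT] at hold
      rw [hold] at h1
      exact (P e.center).symm.injective (Fin.ext (le_antisymm h1 (hnew.2 _ hm)))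
    · rw [List.mem_singleton] at he
      subst he
      exact fun _ => rfl
  · rw [hmap]
    intro A C x hAC u y hy
    rcases List.eq_nil_or_concat' C with rfl | ⟨C', z, rfl⟩
    · obtain ⟨rfl, hx⟩ := List.append_inj' hAC rfl
      obtain rfl : w = x := by simpa using hx
      obtain ⟨e, he, heu⟩ := hnear u
      obtain ⟨f, hf, rfl⟩ := List.mem_map.1 hy
      refine ⟨e.center, List.mem_map_of_mem he, ?_⟩
      rw [dist_comm u, dist_comm w]
      exact heu.trans (hw f hf)
    · have hAC' : T ++ [w] = (A ++ x :: C') ++ [z] := by rw [hAC]; simp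
      obtain ⟨hT', -⟩ := List.append_inj' hAC' rfl
      exact h.greedy A C' x hT' u y hy
  · -- the centers whose credit does not cover the distance to `w`
    have hviol : (∀ e ∈ es, 4 * e.radius ≤ 2 ^ a e.center * dist e.center w) ∨
        ∃ m ∈ es, ∀ e ∈ es, e ≠ m → 4 * e.radius ≤ 2 ^ a e.center * dist e.center w := by
      refine List.Pairwise.forall_or_exists_unique ha fun e he f hf hef => ?_
      by_contra! hcon
      obtain ⟨h1, h2⟩ := hcon
      have hp1 : (1 : ℝ) ≤ 2 ^ a e.center := one_le_pow₀ (by norm_num)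
      have hp2 : (1 : ℝ) ≤ 2 ^ a f.center := one_le_pow₀ (by norm_num)
      have h3 : dist e.center w ≤ 8 * dist f.center w := by
        have := mul_le_mul_of_nonneg_right hp1 (dist_nonneg (x := e.center) (y := w))
        linarith [hB e he, hw f hf]
      have h4 : 16 * dist f.center w < dist e.center f.center := by
        have h5 : 2 ^ a f.center * (16 * dist f.center w) <
            2 ^ a f.center * dist e.center f.center := by linarith [hef.2]
        exact lt_of_mul_lt_mul_left h5 (by linarith)
      have h6 := dist_triangle_right e.center f.center w
      linarith [dist_nonneg (x := f.center) (y := w)]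
    -- three units of credit cover every distance `δ ≥ B / 2`, since `4 * B ≤ 8 * δ`
    obtain ⟨b, hb1, hb2, hb3⟩ : ∃ b : U → ℕ, (∀ x, a x ≤ b x) ∧
        (∀ e ∈ es, 4 * e.radius ≤ 2 ^ b e.center * dist e.center w) ∧
        (T.map b).sum ≤ (T.map a).sum + 3 := by
      rcases hviol with hok | ⟨m, hm, hok⟩
      · exact ⟨a, fun _ => le_rfl, hok, by omega⟩
      · refine ⟨Function.update a m.center (a m.center + 3), fun x => ?_, fun e he => ?_,
          List.sum_map_update_add_three a _ T h.nodup⟩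
        · rcases eq_or_ne x m.center with rfl | hx
          · simp
          · simp [hx]
        · rcases eq_or_ne e.center m.center with hc | hc
          · rw [hc, Function.update_self, ← hc, pow_add]
            have hp1 : (1 : ℝ) ≤ 2 ^ a e.center := one_le_pow₀ (by norm_num)
            have h1 := mul_le_mul_of_nonneg_right hp1 (dist_nonneg (x := e.center) (y := w))
            linarith [hB e he, hw e he]
          · rw [Function.update_of_ne hc]
            exact hok e he fun hem => hc (hem ▸ rfl)
    -- all distances of `w` count as divided by `16 = 2 ^ 4`, so `w` needs four more units
    refine ⟨Function.update b w 7, ?_, ?_⟩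
    · unfold Affordable
      rw [List.pairwise_append]
      refine ⟨?_, by simp, ?_⟩
      · refine List.Pairwise.imp_of_mem ?_ ha
        intro x y hx hy hxy
        have hxw : x.center ≠ w := fun hxw => hwT (hxw ▸ List.mem_map_of_mem hx)
        have hyw : y.center ≠ w := fun hyw => hwT (hyw ▸ List.mem_map_of_mem hy)
        rw [Function.update_of_ne hxw, Function.update_of_ne hyw]
        have hmono : ∀ z, (2 : ℝ) ^ a z * dist x.center y.center ≤
            2 ^ b z * dist x.center y.center := fun z =>
          mul_le_mul_of_nonneg_right (pow_le_pow_right₀ (by norm_num) (hb1 z)) dist_nonneg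
        exact ⟨hxy.1.trans (hmono _), hxy.2.trans (hmono _)⟩
      · intro x hx y hy
        rw [List.mem_singleton] at hy
        subst hy
        have hxw : x.center ≠ w := fun hxw => hwT (hxw ▸ List.mem_map_of_mem hx)
        simp only [Function.update_of_ne hxw, Function.update_self]
        exact ⟨hb2 x hx, by linarith [hw x hx]⟩
    · have : T.map (Function.update b w 7) = T.map b :=
        List.map_congr_left fun y hy => by
          rw [Function.update_of_ne]; rintro rfl; exact hwT hy
      rw [List.map_append, List.sum_append, this]
      simp only [List.map_cons, List.map_nil, List.sum_cons, List.sum_nil, Function.update_self]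
      omega

open Classical in
/-- The number of entries whose witness is outdated. -/
noncomputable def staleCount (P : Profile U) (T : List U) (es : List (CenterEntry U)) : ℕ :=
  es.countP fun x => decide (P.farthestIn x.center (P.cluster T x.center) ≠ x.witness)

/-- Each opened center costs twelve units: at most two queries and ten units of new credit.  A round
that opens no center is paid by one unit of credit of the center it looks at, and it reduces the
number of outdated witnesses, so that the rounds suffice. -/
theorem growCenters_spec (hP : P.Consistent) (fuel : ℕ) (es : List (CenterEntry U))
    (h : GoodEntries P es) (hne : es ≠ []) (hlen : es.length < Fintype.card U)
    (hfuel : staleCount P (es.map CenterEntry.center) es < fuel) (a : U → ℕ)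
    (ha : Affordable a es) :
    GoodEntries P ((growCenters P fuel es).run dist) ∧
      ((growCenters P fuel es).run dist).length = es.length + 1 ∧
      ∃ a' : U → ℕ, Affordable a' ((growCenters P fuel es).run dist) ∧
        (growCenters P fuel es).count dist +
          ((((growCenters P fuel es).run dist).map CenterEntry.center).map a').sum ≤
          ((es.map CenterEntry.center).map a).sum + 12 := by
  classical
  induction fuel generalizing es a with
  | zero => omega
  | succ fuel ih =>
    rw [growCenters]
    split
    · rename_i hnone
      exact absurd (List.argmax_eq_none.1 hnone) hne
    rename_i e hsome
    have he : e ∈ es := List.argmax_mem hsome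
    have hmax : ∀ x ∈ es, x.radius ≤ e.radius := fun x hx => List.le_of_mem_argmax hx hsome
    have hmem : e.center ∈ es.map CenterEntry.center := List.mem_map_of_mem he
    obtain ⟨w, hwdef⟩ : ∃ w, w = P.farthestIn e.center
      (P.cluster (es.map CenterEntry.center) e.center) := ⟨_, rfl⟩
    have hwmem : w ∈ P.cluster (es.map CenterEntry.center) e.center :=
      hwdef ▸ (Profile.farthestIn_spec (P := P) _ ⟨_, hP.self_mem_cluster hmem⟩).1
    have hwc : ∀ x ∈ es, dist e.center w ≤ dist x.center w := fun x hx => by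
      rw [dist_comm, dist_comm x.center]
      exact hP.dist_cluster_le hwmem (List.mem_map_of_mem hx)
    have hpos : 0 < e.radius := by
      obtain ⟨u, hu⟩ : ∃ u, u ∉ es.map CenterEntry.center := by
        by_contra! hall
        have h1 : Fintype.card U ≤ (es.map CenterEntry.center).toFinset.card := by
          rw [← Finset.card_univ]
          exact Finset.card_le_card fun u _ => List.mem_toFinset.2 (hall u)
        have h2 := (es.map CenterEntry.center).toFinset_card_le
        rw [List.length_map] at h2
        omega
      obtain ⟨c, hc, huc⟩ := P.exists_mem_cluster (T := es.map CenterEntry.center)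
        (by simpa using hne) u
      obtain ⟨x, hx, rfl⟩ := List.mem_map.1 hc
      have hd : 0 < dist x.center u := dist_pos.2 fun hxu => hu (hxu ▸ hc)
      exact hd.trans_le ((h.le_radius x hx u huc).trans (hmax x hx))
    simp only [← hwdef]
    split
    · rename_i hww
      obtain ⟨h1, h2, h3, a', h4, h5⟩ := addCenter_spec hP h hne hmax hpos (w := w)
        (fun x hx => by
          have := h.radius_eq e he
          rw [← hww] at this
          linarith [hwc x hx, dist_nonneg (x := e.center) (y := w)]) ha
      exact ⟨h1, h2, a', h4, by omega⟩
    · rename_i hww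
      have hr : dist e.center w ≤ e.radius := h.le_radius e he w hwmem
      have hgood := h.refresh hP he hwdef
      have hcent := e.map_refresh_center w (dist e.center w) es
      have hlen' : (es.map (e.refresh w (dist e.center w))).length = es.length := by simp
      have hne' : es.map (e.refresh w (dist e.center w)) ≠ [] := by simpa using hne
      have hfun : (es.map fun x => if x.center = e.center then
          (⟨e.center, w, dist e.center w⟩ : CenterEntry U) else x) =
          es.map (e.refresh w (dist e.center w)) := rfl
      simp only [QueryM.run_bind, QueryM.count_bind]
      by_cases hlt : e.radius ≤ 2 * (QueryM.ask e.center w).run dist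
      · rw [if_pos hlt]
        simp only [QueryM.run_ask, QueryM.count_ask, hfun] at hlt ⊢
        have haff : Affordable a (es.map (e.refresh w (dist e.center w))) := by
          refine ha.refresh fun x hx D hD hxD => ?_
          unfold CenterEntry.refresh
          split
          · rename_i hxe
            obtain rfl : x = e := List.inj_on_of_nodup_map h.nodup hx he hxe
            simp only
            linarith
          · exact hxD
        obtain ⟨h1, h2, h3, a', h4, h5⟩ := addCenter_spec hP hgood hne' (B := e.radius)
          (fun x hx => by
            obtain ⟨y, hy, rfl⟩ := List.mem_map.1 hx
            unfold CenterEntry.refresh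
            split
            · exact hr
            · exact hmax y hy) hpos (w := w)
          (fun x hx => by
            obtain ⟨y, hy, rfl⟩ := List.mem_map.1 hx
            rw [e.refresh_center]
            linarith [hwc y hy]) haff
        rw [hlen'] at h2
        rw [hcent] at h5
        exact ⟨h1, h2, a', h4, by omega⟩
      · rw [if_neg hlt]
        simp only [QueryM.run_ask, QueryM.count_ask, hfun] at hlt ⊢
        rw [not_le] at hlt
        -- the witness was taken over by another center
        obtain ⟨c, hc, hce, hcd⟩ : ∃ c ∈ es, c ≠ e ∧ dist e.center c.center ≤ 2 * e.radius := by
          have hout : e.witness ∉ P.cluster (es.map CenterEntry.center) e.center := fun hin =>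
            hww (hwdef.trans (h.witness_eq e he hin))
          obtain ⟨c, hc, hcu⟩ := P.exists_mem_cluster (T := es.map CenterEntry.center)
            (by simpa using hne) e.witness
          obtain ⟨x, hx, rfl⟩ := List.mem_map.1 hc
          refine ⟨x, hx, fun hxe => hout (hxe ▸ hcu), ?_⟩
          have h1 := hP.dist_cluster_le hcu hmem
          have h2 := dist_triangle e.center e.witness x.center
          rw [dist_comm e.witness e.center] at h1
          rw [h.radius_eq e he]
          linarith
        -- a center within distance `2 * e.radius` is not compatible with credit `0`
        have hcredit : 1 ≤ a e.center := by
          by_contra! h0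
          have h0 : a e.center = 0 := by omega
          have hor : 4 * e.radius ≤ 2 ^ a e.center * dist e.center c.center := by
            obtain ⟨i, hi, hie⟩ := List.mem_iff_getElem.1 he
            obtain ⟨j, hj, hjc⟩ := List.mem_iff_getElem.1 hc
            rcases lt_trichotomy i j with hij | hij | hij
            · have := (List.pairwise_iff_getElem.1 ha i j hi hj hij).1
              rwa [hie, hjc] at this
            · subst hij
              exact absurd (hjc.symm.trans hie) hce
            · have := (List.pairwise_iff_getElem.1 ha j i hj hi hij).2
              rw [hie, hjc, dist_comm] at this
              linarith
          rw [h0] at hor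
          linarith
        have haff : Affordable (Function.update a e.center (a e.center - 1))
            (es.map (e.refresh w (dist e.center w))) := by
          refine ha.refresh fun x hx D hD hxD => ?_
          unfold CenterEntry.refresh
          split
          · rename_i hxe
            obtain rfl : x = e := List.inj_on_of_nodup_map h.nodup hx he hxe
            simp only [Function.update_self]
            obtain ⟨n, hn⟩ : ∃ n, a x.center = n + 1 := ⟨a x.center - 1, by omega⟩
            rw [hn, pow_succ] at hxD
            rw [hn, Nat.add_sub_cancel]
            linarith
          · rename_i hxe
            rw [Function.update_of_ne hxe]
            exact hxD
        have hstale : staleCount P ((es.map (e.refresh w (dist e.center w))).map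
            CenterEntry.center) (es.map (e.refresh w (dist e.center w))) < fuel := by
          rw [hcent]
          refine lt_of_lt_of_le (List.countP_map_lt _ _ _ ?_ ?_) (Nat.lt_succ_iff.1 hfuel)
          · intro x hx
            unfold CenterEntry.refresh
            split
            · intro hx'
              simp [hwdef] at hx'
            · exact id
          · exact ⟨e, he, by simpa [← hwdef] using hww, by
            unfold CenterEntry.refresh
            rw [if_pos rfl]
            simp [hwdef]⟩
        obtain ⟨h1, h2, a', h4, h5⟩ := ih _ hgood hne' (by rw [hlen']; exact hlen) hstale _ haff
        have hsum := List.sum_map_update_sub_one a hcredit _ hmem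
        rw [hlen'] at h2
        rw [hcent] at h5
        exact ⟨h1, h2, a', h4, by omega⟩

/-- The traversal makes at most twelve queries per center. -/
theorem greedyEntries_spec (hP : P.Consistent) (k : ℕ) (hk : k ≤ Fintype.card U) :
    GoodEntries P ((greedyEntries P k).run dist) ∧
      ((greedyEntries P k).run dist).length = k ∧
      ∃ a : U → ℕ, Affordable a ((greedyEntries P k).run dist) ∧
        (greedyEntries P k).count dist +
          ((((greedyEntries P k).run dist).map CenterEntry.center).map a).sum ≤ 12 * k := by
  induction k with
  | zero =>
    simp only [greedyEntries, QueryM.run_pure', QueryM.count_pure']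
    refine ⟨⟨by simp, by simp, by simp, by simp, ?_⟩, rfl, fun _ => 0, by simp [Affordable],
      by simp⟩
    intro A B x hAB
    simp at hAB
  | succ k ih =>
    obtain ⟨h1, h2, a, h3, h4⟩ := ih (by omega)
    simp only [greedyEntries, QueryM.run_bind, QueryM.count_bind]
    rcases Nat.eq_zero_or_pos k with rfl | hk0
    · have hnil : (greedyEntries P 0).run dist = [] := rfl
      have hU : Nonempty U := Fintype.card_pos_iff.1 (by omega)
      rw [hnil]
      simp only [growCenters, List.argmax_nil, dif_pos hU, addCenter,
        List.map_nil, List.nil_append, QueryM.run_bind, QueryM.run_ask, QueryM.run_pure,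
        QueryM.count_bind, QueryM.count_ask, QueryM.count_pure]
      refine ⟨⟨by simp, by simp, ?_, by simp, ?_⟩, rfl, fun _ => 0, by simp [Affordable], ?_⟩
      · simp only [List.mem_singleton, forall_eq, List.map_cons, List.map_nil]
        exact fun u hu => hP.dist_le_farthestIn _ hu
      · intro A B x hAB u y hy
        cases A with
        | nil => simp at hy
        | cons z A => simp at hAB
      · have : (greedyEntries P 0).count dist = 0 := rfl
        simp [this]
    · have hne : (greedyEntries P k).run dist ≠ [] := by
        intro hnil
        rw [hnil] at h2
        simp at h2
        omega
      obtain ⟨g1, g2, a', g3, g4⟩ := growCenters_spec hP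
        (((greedyEntries P k).run dist).length + 1) _ h1 hne (by omega)
        (Nat.lt_succ_iff.2 List.countP_le_length) a h3
      exact ⟨g1, by omega, a', g3, by omega⟩

end Greedy

theorem halfGreedyList_iff {U : Type} [MetricSpace U] {T : List U} :
    HalfGreedyList T ↔ ∀ (A B : List U) (x : U), T = A ++ x :: B → ∀ u : U,
      Metric.infEDist u {y | y ∈ A} ≤ 2 * Metric.infEDist x {y | y ∈ A} := by
  refine forall_congr' fun A => forall_congr' fun B => forall_congr' fun x =>
    forall_congr' fun _ => forall_congr' fun u => ?_
  rcases eq_or_ne A [] with rfl | hA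
  · simp
  · exact (infEDist_le_two_mul_iff hA u x).symm

theorem ordinalGreedy_isHalfGreedy : IsHalfGreedy ordinalGreedy 12 := by
  intro U _ _ P k hP _ hk
  obtain ⟨h1, h2, a, h3, h4⟩ := greedyEntries_spec hP k hk
  have hrun : (ordinalGreedy U P k).run dist =
      ((greedyEntries P k).run dist).map CenterEntry.center := by
    simp [ordinalGreedy]
  have hcount : (ordinalGreedy U P k).count dist = (greedyEntries P k).count dist := by
    simp [ordinalGreedy]
  rw [hrun, hcount]
  refine ⟨by simpa using h2, h1.nodup, halfGreedyList_iff.1 h1.greedy, ?_⟩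
  have : (greedyEntries P k).count dist ≤ 12 * k := by omega
  exact_mod_cast this

/-! ### Projection graphs and the predicate of the main phase -/

section ProjectionGraph

variable {U : Type} [Fintype U] (I : OrdFairInstance U)

theorem mem_groupOrder (s : U) (j : Fin I.k) : j ∈ groupOrder I s := by
  rw [groupOrder, List.mem_mergeSort]
  exact List.mem_finRange j

theorem length_groupOrder (s : U) : (groupOrder I s).length = I.k := by
  rw [groupOrder, List.length_mergeSort, List.length_finRange]

variable [MetricSpace U]

/-- The distance of a point to a group. -/
noncomputable def OrdFairInstance.groupDist (s : U) (j : Fin I.k) : ℝ := dist s (I.closest s j)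

/-- The projection graph on the centers `T` with threshold `lam` has a left-perfect matching. -/
def Matchable (T : List U) (lam : ℝ) : Prop :=
  ∃ M : List (Fin I.k), M.Nodup ∧ List.Forall₂ (fun j s => I.groupDist s j ≤ lam) M T

open Classical in
/-- The adjacency lists of the projection graph with threshold `lam`. -/
noncomputable def graphAt (T : List U) (lam : ℝ) : List (List (Fin I.k)) :=
  T.map fun s => (groupOrder I s).filter fun j => decide (I.groupDist s j ≤ lam)

theorem isLeftPerfectMatching_graphAt (T : List U) (lam : ℝ) (M : List (Fin I.k)) :
    IsLeftPerfectMatching (graphAt I T lam) M ↔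
      M.Nodup ∧ List.Forall₂ (fun j s => I.groupDist s j ≤ lam) M T := by
  unfold IsLeftPerfectMatching graphAt
  rw [List.forall₂_map_right_iff]
  simp [mem_groupOrder]

theorem Matchable.mono {T : List U} {a b : ℝ} (h : Matchable I T a) (hab : a ≤ b) :
    Matchable I T b := by
  obtain ⟨M, h1, h2⟩ := h
  exact ⟨M, h1, h2.imp fun _ _ h => h.trans hab⟩

@[simp] theorem run_askGroup (s : U) (j : Fin I.k) :
    (askGroup I s j).run dist = I.groupDist s j := rfl

omit [MetricSpace U] in
@[simp] theorem count_askGroup (d : U → U → ℝ) (s : U) (j : Fin I.k) :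
    (askGroup I s j).count d = 1 := rfl

variable {I}

theorem pairwise_groupOrder (hI : I.pref.Consistent) (s : U) :
    (groupOrder I s).Pairwise fun i j => I.groupDist s i ≤ I.groupDist s j := by
  have h := List.pairwise_mergeSort (le := fun i j : Fin I.k =>
    decide (I.pref.rank s (I.closest s i) ≤ I.pref.rank s (I.closest s j)))
    (by simp only [decide_eq_true_eq]; intro a b c; exact le_trans)
    (by intro a b; simpa using le_total _ _) (List.finRange I.k)
  exact h.imp fun hij => hI.dist_le (by simpa using hij)

theorem run_projectionGraph (hI : I.pref.Consistent) (T : List U) (lam : ℝ) :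
    (projectionGraph I T lam).run dist = graphAt I T lam := by
  rw [projectionGraph, QueryM.run_traverse, graphAt]
  refine List.map_congr_left fun s _ => ?_
  exact QueryM.run_prefixSearch dist _ (fun j => I.groupDist s j ≤ lam) _ _
    (fun j _ => decide_eq_true_iff)
    ((pairwise_groupOrder hI s).imp fun h h' => h.trans h') (length_groupOrder I s).le

variable (I)

theorem count_projectionGraph_le (T : List U) (lam : ℝ) :
    (projectionGraph I T lam).count dist ≤ T.length * Nat.size I.k := by
  refine QueryM.count_traverse_le _ _ _ _ fun s _ => ?_
  have := QueryM.count_prefixSearch_le dist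
    (fun j : Fin I.k => do let r ← askGroup I s j; return decide (r ≤ lam)) (by simp) I.k
    (groupOrder I s)
  rwa [length_groupOrder] at this

omit [Fintype U] [MetricSpace U] in
theorem le_maxList {l : List ℝ} {x : ℝ} (h : x ∈ l) : x ≤ maxList l := by
  induction l with
  | nil => simp at h
  | cons y l ih =>
    rcases List.mem_cons.1 h with rfl | h
    · exact le_max_left _ _
    · exact (ih h).trans (le_max_right _ _)

omit [Fintype U] [MetricSpace U] in
theorem maxList_le {l : List ℝ} {c : ℝ} (hc : 0 ≤ c) (h : ∀ x ∈ l, x ≤ c) : maxList l ≤ c := by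
  induction l with
  | nil => exact hc
  | cons y l ih =>
    exact max_le (h y (by simp)) (ih fun x hx => h x (List.mem_cons_of_mem _ hx))

theorem run_coverCost (T : List U) : (coverCost I T).run dist =
    maxList (T.map fun s => dist s (I.pref.farthestIn s (I.pref.cluster T s))) := by
  simp [coverCost]

theorem count_coverCost_le (T : List U) : (coverCost I T).count dist ≤ T.length := by
  have := QueryM.count_traverse_le dist
    (fun s => QueryM.ask s (I.pref.farthestIn s (I.pref.cluster T s))) T 1 (by simp)
  simpa [coverCost] using this

variable {I}

theorem exists_dist_le_coverCost (hI : I.pref.Consistent) {T : List U} (hT : T ≠ []) (u : U) :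
    ∃ s ∈ T, dist u s ≤ (coverCost I T).run dist := by
  obtain ⟨c, hc, hu⟩ := I.pref.exists_mem_cluster hT u
  refine ⟨c, hc, ?_⟩
  rw [run_coverCost, dist_comm]
  exact (hI.dist_le_farthestIn c hu).trans (le_maxList (List.mem_map_of_mem hc))

theorem coverCost_le (hI : I.pref.Consistent) {T : List U} {r : ℝ} (hr : 0 ≤ r)
    (h : ∀ u, ∃ s ∈ T, dist u s ≤ r) : (coverCost I T).run dist ≤ r := by
  rw [run_coverCost]
  refine maxList_le hr fun x hx => ?_
  obtain ⟨s, hs, rfl⟩ := List.mem_map.1 hx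
  have hw := (Profile.farthestIn_spec (P := I.pref) s ⟨s, hI.self_mem_cluster hs⟩).1
  obtain ⟨c, hc, hcr⟩ := h (I.pref.farthestIn s (I.pref.cluster T s))
  rw [dist_comm]
  exact (hI.dist_cluster_le hw hc).trans hcr

theorem run_evalPredicate (hI : I.pref.Consistent) (T : List U) (l : ℕ) :
    (evalPredicate I T l).run dist = true ↔
      Matchable I (T.take l) ((coverCost I (T.take l)).run dist / 4) := by
  simp only [evalPredicate, QueryM.run_bind, run_projectionGraph hI, QueryM.run_pure,
    decide_eq_true_eq, isLeftPerfectMatching_graphAt]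
  rfl

variable (I)

theorem count_evalPredicate_le (T : List U) (l : ℕ) :
    (evalPredicate I T l).count dist ≤ T.length * (1 + Nat.size I.k) := by
  simp only [evalPredicate, QueryM.count_bind, QueryM.count_pure, add_zero]
  have h1 := count_coverCost_le I (T.take l)
  have h2 := count_projectionGraph_le I (T.take l) ((coverCost I (T.take l)).run dist / 4)
  have h3 : (T.take l).length ≤ T.length := by rw [List.length_take]; exact min_le_right _ _
  have h4 := Nat.mul_le_mul_right (Nat.size I.k) h3
  rw [mul_add, mul_one]
  omega

end ProjectionGraph

/-! ### The median of medians search -/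

section MedianSearch

theorem List.drop_length_filter {α : Type*} (p : α → Bool) (l : List α)
    (h : l.Pairwise fun i j => p j = true → p i = true) :
    l.drop (l.filter p).length = l.filter fun x => !p x := by
  induction l with
  | nil => rfl
  | cons x l ih =>
    rw [List.pairwise_cons] at h
    by_cases hx : p x
    · simp [hx, ih h.2]
    · have h1 : l.filter p = [] := List.filter_eq_nil_iff.2 fun y hy hpy => hx (h.1 y hy hpy)
      have h2 : (l.filter fun x => !p x) = l := List.filter_eq_self.2 fun y hy => by
        have : ¬ p y = true := fun hpy => hx (h.1 y hy hpy)
        simpa using this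
      simp [hx, h1, h2]

/-- If the upper half of a sorted list fails a test, at most half of its entries pass. -/
theorem two_mul_length_filter_le_of_upper {α : Type*} {f : α → ℝ} {l : List α}
    (hl : l.Pairwise fun i j => f i ≤ f j) {m : α} (hm : l[l.length / 2]? = some m)
    (p : α → Bool) (hp : ∀ x, f m ≤ f x → p x = false) :
    2 * (l.filter p).length ≤ l.length := by
  obtain ⟨hlt, hm⟩ := List.getElem?_eq_some_iff.1 hm
  have hd : (l.drop (l.length / 2)).filter p = [] := by
    refine List.filter_eq_nil_iff.2 fun x hx => ?_
    rw [List.drop_eq_getElem_cons hlt, hm] at hx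
    have hpd := hl.sublist (List.drop_sublist (l.length / 2) l)
    rw [List.drop_eq_getElem_cons hlt, hm, List.pairwise_cons] at hpd
    rw [hp x]
    · simp
    · rcases List.mem_cons.1 hx with rfl | hx
      · exact le_rfl
      · exact hpd.1 x hx
  have h1 : l.filter p = (l.take (l.length / 2)).filter p := by
    conv_lhs => rw [← List.take_append_drop (l.length / 2) l]
    rw [List.filter_append, hd, List.append_nil]
  have h2 := List.length_filter_le p (l.take (l.length / 2))
  rw [List.length_take] at h2
  rw [h1]
  omega

/-- If the lower half of a sorted list fails a test, at most half of its entries pass. -/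
theorem two_mul_length_filter_le_of_lower {α : Type*} {f : α → ℝ} {l : List α}
    (hl : l.Pairwise fun i j => f i ≤ f j) {m : α} (hm : l[l.length / 2]? = some m)
    (p : α → Bool) (hp : ∀ x, f x ≤ f m → p x = false) :
    2 * (l.filter p).length ≤ l.length := by
  obtain ⟨hlt, hm⟩ := List.getElem?_eq_some_iff.1 hm
  have hd : (l.take (l.length / 2 + 1)).filter p = [] := by
    refine List.filter_eq_nil_iff.2 fun x hx => ?_
    rw [hp x]
    · simp
    · obtain ⟨i, hi, rfl⟩ := List.mem_take_iff_getElem.1 hx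
      have hi' : i ≤ l.length / 2 := by omega
      rcases hi'.lt_or_eq with hi' | rfl
      · rw [← hm]
        exact List.pairwise_iff_getElem.1 hl i _ _ hlt hi'
      · rw [hm]
  have h1 : l.filter p = (l.drop (l.length / 2 + 1)).filter p := by
    conv_lhs => rw [← List.take_append_drop (l.length / 2 + 1) l]
    rw [List.filter_append, hd, List.nil_append]
  have h2 := List.length_filter_le p (l.drop (l.length / 2 + 1))
  rw [List.length_drop] at h2
  rw [h1]
  omega

theorem exists_split_weightedMedian (total : ℕ) (L : List (ℕ × ℝ)) (acc : ℕ)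
    (h1 : 2 * acc < total) (h2 : total ≤ 2 * (acc + (L.map Prod.fst).sum)) :
    ∃ A w B, L = A ++ (w, weightedMedian total acc L) :: B ∧
      2 * (acc + (A.map Prod.fst).sum) < total ∧
      total ≤ 2 * (acc + (A.map Prod.fst).sum + w) := by
  induction L generalizing acc with
  | nil => simp at h2; omega
  | cons z L ih =>
    obtain ⟨w, x⟩ := z
    rw [weightedMedian]
    split
    · rename_i h
      exact ⟨[], w, L, by simp, by simpa using h1, by simpa using h⟩
    · rename_i h
      obtain ⟨A, w', B, hL, h3, h4⟩ := ih (acc + w) (by omega)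
        (by simpa [add_assoc] using h2)
      refine ⟨(w, x) :: A, w', B, by rw [List.cons_append, ← hL], ?_, ?_⟩
      · simpa [add_assoc] using h3
      · simpa [add_assoc] using h4

/-- At least half of the weight lies on either side of the weighted median. -/
theorem weightedMedian_spec {L : List (ℕ × ℝ)} (hL : L.Pairwise fun a b => a.2 ≤ b.2)
    (hpos : 0 < (L.map Prod.fst).sum) :
    (∃ w, (w, weightedMedian (L.map Prod.fst).sum 0 L) ∈ L) ∧
    (L.map Prod.fst).sum ≤ 2 * (L.map fun a =>
      if weightedMedian (L.map Prod.fst).sum 0 L ≤ a.2 then a.1 else 0).sum ∧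
    (L.map Prod.fst).sum ≤ 2 * (L.map fun a =>
      if a.2 ≤ weightedMedian (L.map Prod.fst).sum 0 L then a.1 else 0).sum := by
  obtain ⟨total, htot⟩ : ∃ total, total = (L.map Prod.fst).sum := ⟨_, rfl⟩
  rw [← htot] at hpos ⊢
  obtain ⟨A, w, B, hsplit, h1, h2⟩ := exists_split_weightedMedian total L 0
    (by omega) (by omega)
  generalize weightedMedian total 0 L = tau at *
  subst hsplit
  rw [List.pairwise_append, List.pairwise_cons] at hL
  obtain ⟨-, ⟨hB, -⟩, hA⟩ := hL
  have hB' : (B.map fun a : ℕ × ℝ => if tau ≤ a.2 then a.1 else 0) = B.map Prod.fst :=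
    List.map_congr_left fun b hb => if_pos (hB b hb)
  have hA' : (A.map fun a : ℕ × ℝ => if a.2 ≤ tau then a.1 else 0) = A.map Prod.fst :=
    List.map_congr_left fun a ha => if_pos (hA a ha (w, tau) (by simp))
  refine ⟨⟨w, by simp⟩, ?_, ?_⟩
  · rw [List.map_append, List.map_cons, hB']
    simp only [List.map_append, List.map_cons, List.sum_append, List.sum_cons, le_refl,
      if_true] at htot ⊢
    omega
  · rw [List.map_append, List.map_cons, hA']
    simp only [List.map_append, List.map_cons, List.sum_append, List.sum_cons, le_refl,
      if_true] at htot ⊢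
    omega

end MedianSearch

section MedianSearch

variable {U : Type} [Fintype U] [MetricSpace U] {I : OrdFairInstance U}

/-- The number of remaining candidates. -/
def candidateCount {U : Type} {k : ℕ} (D : List (U × List (Fin k))) : ℕ :=
  (D.map fun row => row.2.length).sum

/-- The length of a row and the distance of its median candidate; `none` for an empty row. -/
noncomputable def rowMedian (I : OrdFairInstance U) (row : U × List (Fin I.k)) : Option (ℕ × ℝ) :=
  (row.2[row.2.length / 2]?).map fun m => (row.2.length, I.groupDist row.1 m)

theorem List.sum_map_filterMap {α β : Type*} (F : α → Option β) (φ : β → ℕ) (l : List α) :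
    ((l.filterMap F).map φ).sum = (l.map fun x => (F x).elim 0 φ).sum := by
  induction l with
  | nil => rfl
  | cons x l ih =>
    rw [List.filterMap_cons, List.map_cons, List.sum_cons, ← ih]
    cases F x <;> simp

theorem List.two_mul_sum_map_add_le {α : Type*} {f g h : α → ℕ} {l : List α}
    (H : ∀ x ∈ l, 2 * f x + g x ≤ 2 * h x) :
    2 * (l.map f).sum + (l.map g).sum ≤ 2 * (l.map h).sum := by
  induction l with
  | nil => simp
  | cons x l ih =>
    have h1 := H x (by simp)
    have h2 := ih fun y hy => H y (List.mem_cons_of_mem _ hy)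
    simp only [List.map_cons, List.sum_cons]
    omega

theorem elim_rowMedian_fst (row : U × List (Fin I.k)) :
    (rowMedian I row).elim 0 Prod.fst = row.2.length := by
  unfold rowMedian
  cases h : row.2[row.2.length / 2]? with
  | none =>
    rw [List.getElem?_eq_none_iff] at h
    simp only [Option.map_none, Option.elim_none]
    omega
  | some m => rfl

theorem pivot_spec (D : List (U × List (Fin I.k))) (hD : 0 < candidateCount D) :
    (∃ row ∈ D, ∃ j ∈ row.2, I.groupDist row.1 j = (pivot I D).run dist) ∧
    candidateCount D ≤ 2 * (D.map fun row => (rowMedian I row).elim 0 fun a =>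
      if (pivot I D).run dist ≤ a.2 then a.1 else 0).sum ∧
    candidateCount D ≤ 2 * (D.map fun row => (rowMedian I row).elim 0 fun a =>
      if a.2 ≤ (pivot I D).run dist then a.1 else 0).sum := by
  set L := (D.filterMap (rowMedian I)).mergeSort fun a b => decide (a.2 ≤ b.2) with hLdef
  have hperm : L.Perm (D.filterMap (rowMedian I)) := List.mergeSort_perm _ _
  have hsum : ∀ φ : ℕ × ℝ → ℕ,
      (L.map φ).sum = (D.map fun row => (rowMedian I row).elim 0 φ).sum := fun φ => by
    rw [(hperm.map φ).sum_eq, List.sum_map_filterMap]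
  have htot : (L.map Prod.fst).sum = candidateCount D := by
    rw [hsum, candidateCount]
    congr 1
    exact List.map_congr_left fun row _ => elim_rowMedian_fst row
  have hrun : (pivot I D).run dist = weightedMedian (candidateCount D) 0 L := by
    simp only [pivot, QueryM.run_bind, QueryM.run_traverse, QueryM.run_pure, run_askGroup,
      List.map_filterMap, Option.map_map]
    rfl
  have hsorted : L.Pairwise fun a b => a.2 ≤ b.2 := by
    have h := List.pairwise_mergeSort (le := fun a b : ℕ × ℝ => decide (a.2 ≤ b.2))
      (by simp only [decide_eq_true_eq]; intro a b c; exact le_trans)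
      (by intro a b; simpa using le_total _ _) (D.filterMap (rowMedian I))
    exact h.imp fun hab => by simpa using hab
  obtain ⟨⟨w, h1⟩, h2, h3⟩ := weightedMedian_spec hsorted (by rw [htot]; exact hD)
  rw [htot, ← hrun] at h1 h2 h3
  rw [hsum] at h2 h3
  refine ⟨?_, h2, h3⟩
  obtain ⟨row, hrow, hr⟩ := List.mem_filterMap.1 (hperm.mem_iff.1 h1)
  unfold rowMedian at hr
  obtain ⟨m, hm, hmr⟩ := Option.map_eq_some_iff.1 hr
  exact ⟨row, hrow, m, List.mem_of_getElem? hm, (Prod.mk.inj hmr).2⟩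

theorem count_pivot_le (D : List (U × List (Fin I.k))) : (pivot I D).count dist ≤ D.length := by
  simp only [pivot, QueryM.count_bind, QueryM.count_pure, add_zero]
  refine (QueryM.count_traverse_le dist _ _ 1 fun x _ => by simp).trans ?_
  rw [mul_one]
  exact List.length_filterMap_le _ _

/-- What holds for the state of the search at any time: the smallest feasible threshold is `best`
or one of the remaining candidates. -/
structure SearchInv (T : List U) (st : SearchState U I.k) : Prop where
  rows : st.space.map Prod.fst = T
  sorted : ∀ row ∈ st.space,
    row.2.Pairwise fun i j => I.groupDist row.1 i ≤ I.groupDist row.1 j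
  length_le : ∀ row ∈ st.space, row.2.length ≤ I.k
  le_best : ∀ row ∈ st.space, ∀ j ∈ row.2, I.groupDist row.1 j ≤ st.best
  graph_eq : st.graph = graphAt I T st.best
  matchable : Matchable I T st.best
  removed : ∀ row ∈ st.space, ∀ j, j ∉ row.2 →
    st.best ≤ I.groupDist row.1 j ∨ ¬ Matchable I T (I.groupDist row.1 j)

open Classical in
/-- Only the candidates that satisfy `Q` are kept. -/
theorem SearchInv.filter {T : List U} {st st' : SearchState U I.k} (h : SearchInv T st)
    (Q : ℝ → Prop)
    (hst : st'.space = st.space.map fun row =>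
      (row.1, row.2.filter fun j => decide (Q (I.groupDist row.1 j))))
    (hbest : st'.best ≤ st.best) (hle : ∀ x, Q x → x ≤ st.best → x ≤ st'.best)
    (hg : st'.graph = graphAt I T st'.best) (hm : Matchable I T st'.best)
    (hrem : ∀ x, ¬ Q x → st'.best ≤ x ∨ ¬ Matchable I T x) : SearchInv T st' := by
  refine ⟨?_, ?_, ?_, ?_, hg, hm, ?_⟩
  · rw [hst, List.map_map, ← h.rows]; rfl
  · intro row hrow
    rw [hst] at hrow
    obtain ⟨r, hr, rfl⟩ := List.mem_map.1 hrow
    exact (h.sorted r hr).sublist List.filter_sublist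
  · intro row hrow
    rw [hst] at hrow
    obtain ⟨r, hr, rfl⟩ := List.mem_map.1 hrow
    exact (List.length_filter_le _ _).trans (h.length_le r hr)
  · intro row hrow j hj
    rw [hst] at hrow
    obtain ⟨r, hr, rfl⟩ := List.mem_map.1 hrow
    simp only [List.mem_filter, decide_eq_true_eq] at hj
    exact hle _ hj.2 (h.le_best r hr j hj.1)
  · intro row hrow j hj
    rw [hst] at hrow
    obtain ⟨r, hr, rfl⟩ := List.mem_map.1 hrow
    simp only [List.mem_filter, decide_eq_true_eq, not_and] at hj
    by_cases hjr : j ∈ r.2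
    · exact hrem _ (hj hjr)
    · exact (h.removed r hr j hjr).imp_left hbest.trans

/-- Each round of the search preserves the invariant and discards a quarter of the candidates. -/
theorem medianStep_spec (hI : I.pref.Consistent) {T : List U} {st : SearchState U I.k}
    (h : SearchInv T st) (hpos : 0 < candidateCount st.space) :
    SearchInv T ((medianStep I T st).run dist) ∧
      4 * candidateCount ((medianStep I T st).run dist).space ≤ 3 * candidateCount st.space ∧
      (medianStep I T st).count dist ≤ T.length * (1 + 2 * Nat.size I.k) := by
  classical
  obtain ⟨⟨prow, hprow, pj, hpj, hpd⟩, hup, hlow⟩ := pivot_spec st.space hpos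
  have hlen : st.space.length = T.length := by rw [← h.rows, List.length_map]
  have hcp := count_pivot_le (I := I) st.space
  obtain ⟨tau, htau⟩ : ∃ tau, tau = (pivot I st.space).run dist := ⟨_, rfl⟩
  have hcg := count_projectionGraph_le I T tau
  have htb : tau ≤ st.best := by
    rw [htau, ← hpd]; exact h.le_best prow hprow pj hpj
  have hmatch : (∃ M, IsLeftPerfectMatching (graphAt I T tau) M) ↔ Matchable I T tau := by
    simp only [isLeftPerfectMatching_graphAt]; rfl
  -- the cost of discarding candidates
  have hcd : ∀ (p : U → Fin I.k → QueryM U Bool) (g : U × List (Fin I.k) → List (Fin I.k) →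
      U × List (Fin I.k)), (∀ s j, (p s j).count dist = 1) →
      (QueryM.traverse (fun row : U × List (Fin I.k) => do
        let q ← QueryM.prefixSearch (p row.1) I.k row.2
        return g row q) st.space).count dist ≤ T.length * Nat.size I.k := by
    intro p g hp
    rw [← hlen]
    refine QueryM.count_traverse_le _ _ _ _ fun row hrow => ?_
    simp only [QueryM.count_bind, QueryM.count_pure, add_zero]
    exact (QueryM.count_prefixSearch_le dist _ (fun j => (hp _ j).le) _ _).trans
      (Nat.size_le_size (h.length_le row hrow))
  have hdist : T.length * (1 + 2 * Nat.size I.k) =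
      T.length + T.length * Nat.size I.k + T.length * Nat.size I.k := by ring
  rw [← htau] at hup hlow
  rw [medianStep]
  simp only [QueryM.run_bind, QueryM.count_bind, run_projectionGraph hI, ← htau]
  by_cases hM : ∃ M, IsLeftPerfectMatching (graphAt I T tau) M
  · rw [if_pos hM]
    simp only [QueryM.run_bind, QueryM.count_bind, QueryM.run_pure, QueryM.count_pure,
      QueryM.run_traverse]
    have hspace : (st.space.map fun row : U × List (Fin I.k) => (row.1,
        (QueryM.prefixSearch (fun j => do
          let r ← askGroup I row.1 j
          return decide (r < tau)) I.k row.2).run dist)) =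
        st.space.map fun row => (row.1, row.2.filter fun j =>
          decide (I.groupDist row.1 j < tau)) := by
      refine List.map_congr_left fun row hrow => ?_
      rw [QueryM.run_prefixSearch dist (fun j => do
          let r ← askGroup I row.1 j
          return decide (r < tau)) (fun j => I.groupDist row.1 j < tau) _ _
        (fun j _ => decide_eq_true_iff) ((h.sorted row hrow).imp fun h h' => h.trans_lt h')
        (h.length_le row hrow)]
    rw [hspace]
    refine ⟨h.filter (fun x => x < tau) (by rfl) htb (fun x hx _ => hx.le) rfl (hmatch.1 hM)
      (fun x hx => Or.inl (not_lt.1 hx)), ?_, ?_⟩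
    · have key := List.two_mul_sum_map_add_le (l := st.space)
        (f := fun row => (row.2.filter fun j => decide (I.groupDist row.1 j < tau)).length)
        (g := fun row => (rowMedian I row).elim 0 fun a => if tau ≤ a.2 then a.1 else 0)
        (h := fun row => row.2.length) (fun row hrow => by
          have hl := List.length_filter_le (fun j => decide (I.groupDist row.1 j < tau)) row.2
          unfold rowMedian
          cases hm : row.2[row.2.length / 2]? with
          | none => simp only [Option.map_none, Option.elim_none]; omega
          | some m =>
            simp only [Option.map_some, Option.elim_some]
            split
            · rename_i hle
              have := two_mul_length_filter_le_of_upper (h.sorted row hrow) hm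
                (fun j => decide (I.groupDist row.1 j < tau))
                (fun x hx => by simpa using hle.trans hx)
              omega
            · omega)
      unfold candidateCount at hup ⊢
      rw [List.map_map]
      simp only [Function.comp_def]
      omega
    · have := hcd (fun s j => do let r ← askGroup I s j; return decide (r < tau))
        (fun row q => (row.1, q)) (by simp)
      omega
  · rw [if_neg hM]
    simp only [QueryM.run_bind, QueryM.count_bind, QueryM.run_pure, QueryM.count_pure,
      QueryM.run_traverse]
    have hspace : (st.space.map fun row : U × List (Fin I.k) => (row.1, row.2.drop
        ((QueryM.prefixSearch (fun j => do
          let r ← askGroup I row.1 j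
          return decide (r ≤ tau)) I.k row.2).run dist).length)) =
        st.space.map fun row => (row.1, row.2.filter fun j =>
          decide (tau < I.groupDist row.1 j)) := by
      refine List.map_congr_left fun row hrow => ?_
      rw [QueryM.run_prefixSearch dist (fun j => do
          let r ← askGroup I row.1 j
          return decide (r ≤ tau)) (fun j => I.groupDist row.1 j ≤ tau) _ _
        (fun j _ => decide_eq_true_iff) ((h.sorted row hrow).imp fun h h' => h.trans h')
        (h.length_le row hrow), List.drop_length_filter]
      · congr 2
        funext j
        by_cases hj : I.groupDist row.1 j ≤ tau
        · simp [hj, not_lt.2 hj]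
        · simp [hj, not_le.1 hj]
      · exact (h.sorted row hrow).imp fun h h' => by
          simp only [decide_eq_true_eq] at h' ⊢
          exact h.trans h'
    rw [hspace]
    refine ⟨h.filter (fun x => tau < x) (by rfl) le_rfl (fun x _ hx => hx) h.graph_eq h.matchable
      (fun x hx => Or.inr fun hx' => hM (hmatch.2 (hx'.mono I (not_lt.1 hx)))), ?_, ?_⟩
    · have key := List.two_mul_sum_map_add_le (l := st.space)
        (f := fun row => (row.2.filter fun j => decide (tau < I.groupDist row.1 j)).length)
        (g := fun row => (rowMedian I row).elim 0 fun a => if a.2 ≤ tau then a.1 else 0)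
        (h := fun row => row.2.length) (fun row hrow => by
          have hl := List.length_filter_le (fun j => decide (tau < I.groupDist row.1 j)) row.2
          unfold rowMedian
          cases hm : row.2[row.2.length / 2]? with
          | none => simp only [Option.map_none, Option.elim_none]; omega
          | some m =>
            simp only [Option.map_some, Option.elim_some]
            split
            · rename_i hle
              have := two_mul_length_filter_le_of_lower (h.sorted row hrow) hm
                (fun j => decide (tau < I.groupDist row.1 j))
                (fun x hx => by simpa using hx.trans hle)
              omega
            · omega)
      unfold candidateCount at hlow ⊢
      rw [List.map_map]
      simp only [Function.comp_def]
      omega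
    · have := hcd (fun s j => do let r ← askGroup I s j; return decide (r ≤ tau))
        (fun row q => (row.1, row.2.drop q.length)) (by simp)
      omega

omit [Fintype U] [MetricSpace U] in
theorem candidateCount_eq_zero_iff {k : ℕ} (D : List (U × List (Fin k))) :
    candidateCount D = 0 ↔ ∀ row ∈ D, row.2 = [] := by
  simp only [candidateCount, List.sum_eq_zero_iff, List.forall_mem_map, List.length_eq_zero_iff]

theorem medianLoop_spec (hI : I.pref.Consistent) {T : List U} (n : ℕ) {st : SearchState U I.k}
    (h : SearchInv T st) (hpos : 0 < candidateCount st.space)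
    (hn : candidateCount st.space * 3 ^ n < 4 ^ n) :
    SearchInv T ((medianLoop I T n st).run dist) ∧
      candidateCount ((medianLoop I T n st).run dist).space = 0 ∧
      (medianLoop I T n st).count dist ≤ n * (T.length * (1 + 2 * Nat.size I.k)) := by
  induction n generalizing st with
  | zero => simp at hn; omega
  | succ n ih =>
    obtain ⟨h1, h2, h3⟩ := medianStep_spec hI h hpos
    rw [medianLoop]
    simp only [QueryM.run_bind, QueryM.count_bind]
    rw [add_mul, one_mul]
    by_cases h0 : ∀ row ∈ ((medianStep I T st).run dist).space, row.2 = []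
    · rw [if_pos h0]
      simp only [QueryM.run_pure, QueryM.count_pure]
      exact ⟨h1, (candidateCount_eq_zero_iff _).2 h0, by omega⟩
    · rw [if_neg h0]
      rw [← candidateCount_eq_zero_iff] at h0
      obtain ⟨g1, g2, g3⟩ := ih h1 (Nat.pos_of_ne_zero h0) (by
        have := Nat.mul_le_mul_right (3 ^ n) h2
        rw [pow_succ, pow_succ] at hn
        nlinarith)
      exact ⟨g1, g2, by omega⟩

/-- The number of rounds suffices to discard all candidates. -/
theorem mul_three_pow_lt_four_pow {m : ℕ} :
    m * 3 ^ (⌊Real.logb (4 / 3) m⌋₊ + 1) < 4 ^ (⌊Real.logb (4 / 3) m⌋₊ + 1) := by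
  rcases Nat.eq_zero_or_pos m with rfl | hm
  · simp
  generalize hn : ⌊Real.logb (4 / 3) m⌋₊ + 1 = n
  have h1 : Real.logb (4 / 3) m < n := by
    rw [← hn]; push_cast; exact Nat.lt_floor_add_one _
  rw [Real.logb_lt_iff_lt_rpow (by norm_num) (by exact_mod_cast hm), Real.rpow_natCast,
    div_pow, lt_div_iff₀ (by positivity)] at h1
  exact_mod_cast h1

theorem rounds_le {k l : ℕ} (hk : 1 ≤ k) (hl : l ≤ k) :
    ⌊Real.logb (4 / 3) (k * l)⌋₊ ≤ 5 * Nat.size k := by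
  rcases Nat.eq_zero_or_pos l with rfl | hl0
  · simp
  apply Nat.floor_le_of_le
  rw [Real.logb_le_iff_le_rpow (by norm_num) (by exact_mod_cast Nat.mul_pos hk hl0)]
  have h1 : k < 2 ^ Nat.size k := Nat.lt_size_self k
  have h2 : ((k * l : ℕ) : ℝ) ≤ ((2 ^ Nat.size k * 2 ^ Nat.size k : ℕ) : ℝ) := by
    exact_mod_cast Nat.mul_le_mul h1.le (hl.trans h1.le)
  push_cast at h2
  refine h2.trans ?_
  -- `4 ≤ (4 / 3) ^ 5`
  rw [← mul_pow, Real.rpow_natCast, pow_mul]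
  exact pow_le_pow_left₀ (by norm_num) (by norm_num) _

theorem findLambda_spec (hI : I.pref.Consistent) {T : List U} (hT : T ≠ [])
    (hTk : T.length ≤ I.k) :
    ((findLambda I T).run dist).graph = graphAt I T ((findLambda I T).run dist).best ∧
      Matchable I T ((findLambda I T).run dist).best ∧
      (∀ lam, Matchable I T lam → ((findLambda I T).run dist).best ≤ lam) ∧
      (findLambda I T).count dist ≤
        T.length + (5 * Nat.size I.k + 1) * (T.length * (1 + 2 * Nat.size I.k)) := by
  classical
  set B := maxList ((T.filterMap fun s => ((groupOrder I s).getLast?).map fun j => (s, j)).map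
    fun x : U × Fin I.k => I.groupDist x.1 x.2) with hB
  have hle : ∀ s ∈ T, ∀ j, I.groupDist s j ≤ B := by
    intro s hs j
    obtain ⟨m, hm⟩ : ∃ m, (groupOrder I s).getLast? = some m :=
      ⟨_, List.getLast?_eq_some_getLast (List.ne_nil_of_mem (mem_groupOrder I s j))⟩
    have h1 : I.groupDist s j ≤ I.groupDist s m := by
      obtain ⟨ys, hys⟩ := List.getLast?_eq_some_iff.1 hm
      have hp := pairwise_groupOrder hI s
      have hj := mem_groupOrder I s j
      rw [hys] at hp hj
      rcases List.mem_append.1 hj with hj | hj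
      · exact (List.pairwise_append.1 hp).2.2 j hj m (by simp)
      · rw [List.mem_singleton.1 hj]
    refine h1.trans (le_maxList (List.mem_map.2 ⟨(s, m), List.mem_filterMap.2 ⟨s, hs, ?_⟩, rfl⟩))
    rw [hm]; rfl
  have hgraph : T.map (groupOrder I) = graphAt I T B := by
    refine List.map_congr_left fun s hs => ?_
    exact (List.filter_eq_self.2 fun j _ => by simpa using hle s hs j).symm
  have hinit : SearchInv T (⟨T.map fun s => (s, groupOrder I s), B, T.map (groupOrder I)⟩ :
      SearchState U I.k) := by
    refine ⟨by simp [Function.comp_def], ?_, ?_, ?_, hgraph, ?_, ?_⟩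
    · intro row hrow
      obtain ⟨s, hs, rfl⟩ := List.mem_map.1 hrow
      exact pairwise_groupOrder hI s
    · intro row hrow
      obtain ⟨s, hs, rfl⟩ := List.mem_map.1 hrow
      exact (length_groupOrder I s).le
    · intro row hrow j _
      obtain ⟨s, hs, rfl⟩ := List.mem_map.1 hrow
      exact hle s hs j
    · refine ⟨(List.finRange I.k).take T.length,
        (List.nodup_finRange _).sublist (List.take_sublist _ _), ?_⟩
      rw [List.forall₂_iff_get]
      refine ⟨by simpa using hTk, fun i _ hi => ?_⟩
      exact hle _ (List.get_mem _ _) _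
    · intro row hrow j hj
      obtain ⟨s, hs, rfl⟩ := List.mem_map.1 hrow
      exact absurd (mem_groupOrder I s j) hj
  have hcount : candidateCount (T.map fun s => (s, groupOrder I s)) = I.k * T.length := by
    simp [candidateCount, Function.comp_def, length_groupOrder, mul_comm]
  have hpos : 0 < I.k * T.length :=
    Nat.mul_pos I.one_le_k (List.length_pos_iff.2 hT)
  have hround := mul_three_pow_lt_four_pow (m := I.k * T.length)
  rw [Nat.cast_mul] at hround
  obtain ⟨h1, h2, h3⟩ := medianLoop_spec hI _ hinit (by rw [hcount]; exact hpos)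
    (by rw [hcount]; exact hround)
  have hrun : (findLambda I T).run dist = (medianLoop I T
      (⌊Real.logb (4 / 3) (I.k * T.length)⌋₊ + 1)
      ⟨T.map fun s => (s, groupOrder I s), B, T.map (groupOrder I)⟩).run dist := by
    simp [findLambda, hB]
  rw [hrun]
  refine ⟨h1.graph_eq, h1.matchable, ?_, ?_⟩
  · rintro lam ⟨M, hM, hMT⟩
    -- the largest distance used by the matching is itself a candidate threshold
    obtain ⟨i, hi, hmax⟩ : ∃ i : ℕ, ∃ hi : i < T.length, ∀ i' (hi' : i' < T.length),
        I.groupDist T[i'] (M[i']'(hi'.trans_eq hMT.length_eq.symm)) ≤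
          I.groupDist T[i] (M[i]'(hi.trans_eq hMT.length_eq.symm)) := by
      have : Nonempty (Fin T.length) := ⟨⟨0, List.length_pos_iff.2 hT⟩⟩
      obtain ⟨i, hi⟩ := Finite.exists_max fun i : Fin T.length =>
        I.groupDist T[i] (M[i.1]'(i.2.trans_eq hMT.length_eq.symm))
      exact ⟨i.1, i.2, fun i' hi' => hi ⟨i', hi'⟩⟩
    have hiM : i < M.length := by rw [hMT.length_eq]; exact hi
    have hfeas : Matchable I T (I.groupDist T[i] (M[i]'hiM)) := by
      refine ⟨M, hM, List.forall₂_iff_get.2 ⟨hMT.length_eq, fun i' _ hi' => ?_⟩⟩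
      simpa using hmax i' hi'
    have hlam : I.groupDist T[i] (M[i]'hiM) ≤ lam := by
      simpa using (List.forall₂_iff_get.1 hMT).2 i hiM hi
    have hmem : T[i] ∈ (((medianLoop I T (⌊Real.logb (4 / 3) (I.k * T.length)⌋₊ + 1)
        ⟨T.map fun s => (s, groupOrder I s), B, T.map (groupOrder I)⟩).run dist).space).map
          Prod.fst := by
      rw [h1.rows]; exact List.getElem_mem _
    obtain ⟨row, hrow, hrs⟩ := List.mem_map.1 hmem
    have hnil := (candidateCount_eq_zero_iff _).1 h2 row hrow
    rcases h1.removed row hrow (M[i]'hiM) (by rw [hnil]; simp) with hr | hr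
    · rw [hrs] at hr; exact hr.trans hlam
    · rw [hrs] at hr; exact absurd hfeas hr
  · simp only [findLambda, QueryM.count_bind, QueryM.run_traverse, run_askGroup]
    refine Nat.add_le_add ?_ (h3.trans (Nat.mul_le_mul_right _
      (Nat.succ_le_succ (rounds_le I.one_le_k hTk))))
    refine (QueryM.count_traverse_le dist _ _ 1 fun x _ => by simp).trans ?_
    rw [mul_one]
    exact List.length_filterMap_le _ _

end MedianSearch

/-! ### Half-greedy traversals and optimal centers -/

section Separation

variable {U : Type} [MetricSpace U]

theorem HalfGreedyList.take {T : List U} (h : HalfGreedyList T) (l : ℕ) :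
    HalfGreedyList (T.take l) := by
  intro A B x hAB
  refine h A (B ++ T.drop l) x ?_
  conv_lhs => rw [← List.take_append_drop l T, hAB]
  simp

/-- Two centers at distance at most `r` show that the centers before the last one cover all points
with radius `2 * r`. -/
theorem HalfGreedyList.pairwise_or_cover {T : List U} (h : HalfGreedyList T) (r : ℝ) :
    (T.Pairwise fun x y => r < dist x y) ∨ ∀ u, ∃ s ∈ T.dropLast, dist u s ≤ 2 * r := by
  by_cases hT : T.Pairwise fun x y => r < dist x y
  · exact Or.inl hT
  right
  rw [List.pairwise_iff_getElem] at hT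
  push Not at hT
  obtain ⟨i, j, hi, hj, hij, hd⟩ := hT
  have hsplit : T = T.take j ++ T[j] :: T.drop (j + 1) := by simp
  intro u
  obtain ⟨s, hs, hus⟩ := h _ _ _ hsplit u T[i] (List.mem_take_iff_getElem.2 ⟨i, by omega, rfl⟩)
  refine ⟨s, ?_, ?_⟩
  · rw [List.dropLast_eq_take]
    exact (List.take_prefix_take_left (by omega)).subset hs
  · rw [dist_comm] at hd
    linarith

/-- Points at mutual distance greater than `2 * o` have distinct nearest centers in a solution of
radius `o`. -/
theorem exists_injective_assignment {S : Finset U} {o : ℝ} (hS : ∀ u, ∃ s ∈ S, dist u s ≤ o)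
    {T : List U} (hT : T.Pairwise fun x y => 2 * o < dist x y) :
    ∃ f : U → U, (∀ u, f u ∈ S ∧ dist u (f u) ≤ o) ∧ (T.map f).Nodup := by
  choose f hf using hS
  refine ⟨f, hf, ?_⟩
  rw [List.Nodup, List.pairwise_map]
  refine hT.imp fun {x y} hxy hfe => ?_
  have h1 := dist_triangle_right x y (f x)
  have h2 := (hf x).2
  have h3 := (hf y).2
  rw [← hfe] at h3
  linarith

/-- A half-greedy sequence with at least as many centers as a solution of radius `o` covers all
points with radius `4 * o`. -/
theorem HalfGreedyList.cover_of_card_le {T : List U} (h : HalfGreedyList T) {S : Finset U}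
    (hST : S.card ≤ T.length) {o : ℝ} (ho : 0 ≤ o) (hS : ∀ u, ∃ s ∈ S, dist u s ≤ o) (u : U) :
    ∃ s ∈ T, dist u s ≤ 4 * o := by
  classical
  rcases h.pairwise_or_cover (2 * o) with hp | hc
  · by_contra! hfar
    have hp' : (u :: T).Pairwise fun x y => 2 * o < dist x y :=
      List.pairwise_cons.2 ⟨fun s hs => by linarith [hfar s hs], hp⟩
    obtain ⟨f, hf, hnd⟩ := exists_injective_assignment hS hp'
    have hle := Finset.card_le_card (s := (List.map f (u :: T)).toFinset)
      (t := S) fun x hx => by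
        obtain ⟨y, -, rfl⟩ := List.mem_map.1 (List.mem_toFinset.1 hx)
        exact (hf y).1
    rw [List.toFinset_card_of_nodup hnd, List.length_map, List.length_cons] at hle
    omega
  · obtain ⟨s, hs, hus⟩ := hc u
    exact ⟨s, List.dropLast_subset _ hs, by linarith⟩

theorem IsHalfGreedy.isFourDistortionKCenter {init : InitialPhase} {c : ℝ}
    (h : IsHalfGreedy init c) : IsFourDistortionKCenter init := by
  intro U _ _ P k hP hk S hS
  obtain ⟨h1, -, h3, -⟩ := h U P k hP hk (hS ▸ Finset.card_le_univ S)
  obtain ⟨o, ho, hcost, hcov⟩ := exists_socialCost_eq_ofReal (S := S)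
    (Finset.card_pos.1 (by omega))
  rw [hcost, show (4 : ℝ≥0∞) = ENNReal.ofReal 4 by simp, ← ENNReal.ofReal_mul (by norm_num)]
  exact socialCost_le_ofReal
    ((halfGreedyList_iff.2 h3).cover_of_card_le (hS.trans h1.symm).le ho hcov)

end Separation

/-! ### The groups with unit requirement -/

section Slots

variable {U : Type} [Fintype U] {I : OrdFairInstance U}

theorem sum_req_le {S : Finset U} (hS : I.Feasible S) : ∑ i, I.req i ≤ I.k := by
  classical
  calc ∑ i, I.req i ≤ ∑ i, (S ∩ I.group i).card := Finset.sum_le_sum fun i _ => by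
        convert hS.2 i
    _ = (Finset.univ.biUnion fun i => S ∩ I.group i).card := by
        refine (Finset.card_biUnion fun i _ j _ hij => ?_).symm
        exact (I.group_disjoint i j hij).mono Finset.inter_subset_right Finset.inter_subset_right
    _ ≤ S.card := Finset.card_le_card
        (Finset.biUnion_subset.2 fun i _ => Finset.inter_subset_left)
    _ = I.k := hS.1

theorem length_slotList (h : ∑ i, I.req i ≤ I.k) : I.slotList.length = I.k := by
  have : (List.map I.req (List.finRange I.t)).sum = ∑ i, I.req i := by
    rw [← List.ofFn_eq_map, List.sum_ofFn]
  simp [OrdFairInstance.slotList, List.length_flatMap, this]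
  omega

theorem List.forall₂_flatMap {α β γ : Type*} {R : β → γ → Prop} {f : α → List β}
    {g : α → List γ} {l : List α} (h : ∀ a ∈ l, List.Forall₂ R (f a) (g a)) :
    List.Forall₂ R (l.flatMap f) (l.flatMap g) := by
  induction l with
  | nil => simp
  | cons a l ih =>
    simp only [List.flatMap_cons]
    exact List.rel_append (h a (by simp)) (ih fun b hb => h b (List.mem_cons_of_mem _ hb))

theorem List.forall₂_mem_replicate {α : Type*} {G : Finset α} {l : List α} {n : ℕ}
    (hn : l.length = n) (h : ∀ x ∈ l, x ∈ G) :
    List.Forall₂ (fun x G => x ∈ G) l (List.replicate n G) := by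
  subst hn
  induction l with
  | nil => simp
  | cons x l ih =>
    rw [List.length_cons, List.replicate_succ]
    exact List.Forall₂.cons (h x (by simp)) (ih fun y hy => h y (List.mem_cons_of_mem _ hy))

/-- The points of a feasible solution can be listed so that they represent the groups with unit
requirement. -/
theorem exists_transversal {S : Finset U} (hS : I.Feasible S) :
    ∃ R : List U, R.Nodup ∧ (∀ x, x ∈ R ↔ x ∈ S) ∧
      List.Forall₂ (fun x G => x ∈ G) R I.slotList := by
  classical
  have hA : ∀ i, ∃ A ⊆ S ∩ I.group i, A.card = I.req i := fun i =>
    Finset.exists_subset_card_eq (by convert hS.2 i)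
  choose A hA hcard using hA
  set R₁ := (List.finRange I.t).flatMap fun i => (A i).toList with hR₁
  have hnd : R₁.Nodup := by
    rw [hR₁, List.nodup_flatMap]
    refine ⟨fun i _ => Finset.nodup_toList _, (List.nodup_finRange _).imp fun {i j} hij => ?_⟩
    intro x hx hx'
    rw [Finset.mem_toList] at hx hx'
    exact Finset.disjoint_left.1 (I.group_disjoint i j hij) (Finset.mem_inter.1 (hA i hx)).2
      (Finset.mem_inter.1 (hA j hx')).2
  have hsub : ∀ x ∈ R₁, x ∈ S := fun x hx => by
    obtain ⟨i, -, hi⟩ := List.mem_flatMap.1 hx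
    exact (Finset.mem_inter.1 (hA i (Finset.mem_toList.1 hi))).1
  have hlen : R₁.length = ∑ i, I.req i := by
    simp [hR₁, List.length_flatMap, hcard]
    rw [← List.ofFn_eq_map, List.sum_ofFn]
  refine ⟨R₁ ++ (S \ R₁.toFinset).toList, ?_, ?_, ?_⟩
  · refine List.nodup_append.2 ⟨hnd, Finset.nodup_toList _, ?_⟩
    rintro x hx y hy rfl
    simp [hx] at hy
  · intro x
    simp only [List.mem_append, Finset.mem_toList, Finset.mem_sdiff, List.mem_toFinset]
    exact ⟨fun h => h.elim (hsub x) And.left, fun h => by tauto⟩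
  · refine List.rel_append (List.forall₂_flatMap fun i _ => ?_) ?_
    · refine List.forall₂_mem_replicate (by simp [hcard]) fun x hx => ?_
      exact (Finset.mem_inter.1 (hA i (Finset.mem_toList.1 hx))).2
    · refine List.forall₂_mem_replicate ?_ (by simp)
      rw [Finset.length_toList, Finset.card_sdiff_of_subset (fun x hx => hsub x (by simpa using hx)),
        List.toFinset_card_of_nodup hnd, hlen, hS.1]

/-- Distinct points of a feasible solution can be assigned to distinct groups that contain
them. -/
theorem exists_slot_assignment {S : Finset U} (hS : I.Feasible S) :
    ∃ g : U → Fin I.k, Set.InjOn g S ∧ ∀ s ∈ S, s ∈ I.slot (g s) := by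
  classical
  obtain ⟨R, hnd, hmem, hR⟩ := exists_transversal hS
  have hlen : R.length = I.k := by
    rw [hR.length_eq, length_slotList (sum_req_le hS)]
  have hidx : ∀ s ∈ S, R.idxOf s < I.k := fun s hs => by
    rw [← hlen]; exact List.idxOf_lt_length_of_mem ((hmem s).2 hs)
  refine ⟨fun s => if h : R.idxOf s < I.k then ⟨R.idxOf s, h⟩ else ⟨0, I.one_le_k⟩, ?_, ?_⟩
  · intro s hs s' hs' hss
    simp only [dif_pos (hidx s hs), dif_pos (hidx s' hs'), Fin.mk.injEq] at hss
    exact (List.idxOf_inj ((hmem s).2 hs)).1 hss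
  · intro s hs
    have hlt : R.idxOf s < R.length := List.idxOf_lt_length_of_mem ((hmem s).2 hs)
    have h2 := (List.forall₂_iff_get.1 hR).2 (R.idxOf s) hlt (by rw [← hR.length_eq]; exact hlt)
    simp only [List.get_eq_getElem, List.getElem_idxOf] at h2
    simp only [dif_pos (hidx s hs)]
    rw [OrdFairInstance.slot,
      List.getD_eq_getElem _ _ (by rw [← hR.length_eq]; exact hlt)]
    exact h2

theorem slot_nonempty {S : Finset U} (hS : I.Feasible S) (j : Fin I.k) : (I.slot j).Nonempty := by
  obtain ⟨R, hnd, hmem, hR⟩ := exists_transversal hS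
  have hl := length_slotList (sum_req_le hS)
  have hj : j.1 < I.slotList.length := by rw [hl]; exact j.2
  have h2 := (List.forall₂_iff_get.1 hR).2 j (by rw [hR.length_eq]; exact hj) hj
  rw [OrdFairInstance.slot, List.getD_eq_getElem _ _ hj]
  exact ⟨_, h2⟩

open Classical in
/-- Representatives of the groups with unit requirement can be supplemented to a feasible
solution, even if they are not distinct. -/
theorem exists_feasible_superset {S : Finset U} (hS : I.Feasible S) (rep : Fin I.k → U)
    (hrep : ∀ j, rep j ∈ I.slot j) : ∃ S', Finset.univ.image rep ⊆ S' ∧ I.Feasible S' := by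
  have hl := length_slotList (sum_req_le hS)
  set R := List.ofFn rep with hRdef
  have hR : List.Forall₂ (fun x G => x ∈ G) R I.slotList := by
    rw [List.forall₂_iff_get]
    refine ⟨by simp [hRdef, hl], fun i hi hi' => ?_⟩
    have := hrep ⟨i, by simpa [hRdef] using hi⟩
    rw [OrdFairInstance.slot, List.getD_eq_getElem _ _ hi'] at this
    simpa [hRdef] using this
  have hmemR : ∀ x, x ∈ Finset.univ.image rep ↔ x ∈ R := by
    intro x; simp [hRdef]
  -- the number of representatives in each group
  have hreq : ∀ i, I.req i ≤ R.countP fun x => decide (x ∈ I.group i) := by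
    intro i
    have h1 : ∀ (R : List U) (L : List (Finset U)), List.Forall₂ (fun x G => x ∈ G) R L →
        L.count (I.group i) ≤ R.countP fun x => decide (x ∈ I.group i) := by
      intro R L h
      induction h with
      | nil => simp
      | @cons x G R L hx _ ih =>
        rw [List.count_cons, List.countP_cons]
        by_cases hG : G = I.group i
        · subst hG
          simpa [hx] using ih
        · simp only [beq_iff_eq, hG, if_false, add_zero]
          exact ih.trans (Nat.le_add_right _ _)
    refine le_trans ?_ (h1 R _ hR)
    rw [OrdFairInstance.slotList, List.count_append, List.count_flatMap]
    refine le_trans ?_ (Nat.le_add_right _ _)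
    refine le_trans ?_ (List.single_le_sum (fun _ _ => Nat.zero_le _) _
      (List.mem_map_of_mem (List.mem_finRange i)))
    simp
  have hsum : ∑ i, R.countP (fun x => decide (x ∈ I.group i)) ≤ I.k := by
    have h1 : ∀ R : List U, ∑ i, R.countP (fun x => decide (x ∈ I.group i)) ≤ R.length := by
      intro R
      induction R with
      | nil => simp
      | cons x R ih =>
        simp only [List.countP_cons, Finset.sum_add_distrib, List.length_cons]
        refine Nat.add_le_add ih ?_
        simp only [decide_eq_true_eq]
        rw [← Finset.sum_filter, Finset.sum_const, smul_eq_mul, mul_one, Finset.card_le_one]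
        intro i hi j hj
        by_contra hij
        simp only [Finset.mem_filter, Finset.mem_univ, true_and] at hi hj
        exact Finset.disjoint_left.1 (I.group_disjoint i j hij) hi hj
    exact (h1 R).trans (by simp [hRdef])
  have hA : ∀ i, ∃ A, (Finset.univ.image rep ∩ I.group i) ⊆ A ∧ A ⊆ I.group i ∧
      A.card = max (Finset.univ.image rep ∩ I.group i).card (I.req i) := by
    intro i
    refine Finset.exists_subsuperset_card_eq Finset.inter_subset_right (le_max_left _ _)
      (max_le (Finset.card_le_card Finset.inter_subset_right) ?_)
    exact (hS.2 i).trans (Finset.card_le_card Finset.inter_subset_right)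
  choose A hA1 hA2 hA3 using hA
  have hcard : (Finset.univ.biUnion A).card ≤ I.k := by
    refine Finset.card_biUnion_le.trans ((Finset.sum_le_sum fun i _ => ?_).trans hsum)
    rw [hA3]
    refine max_le ?_ (hreq i)
    rw [List.countP_eq_length_filter]
    refine le_trans (Finset.card_le_card fun x hx => ?_) (List.toFinset_card_le _)
    rw [Finset.mem_inter, hmemR] at hx
    simpa using hx
  obtain ⟨S', hS', hS'k⟩ := Finset.exists_superset_card_eq hcard
    (hS.1 ▸ Finset.card_le_univ S)
  refine ⟨S', fun x hx => ?_, hS'k, fun i => ?_⟩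
  · obtain ⟨i, hi⟩ := I.group_cover x
    exact hS' (Finset.mem_biUnion.2 ⟨i, Finset.mem_univ i, hA1 i (Finset.mem_inter.2 ⟨hx, hi⟩)⟩)
  · refine le_trans ?_ (Finset.card_le_card (Finset.subset_inter
      ((Finset.subset_biUnion_of_mem A (Finset.mem_univ i)).trans hS') (hA2 i)))
    rw [hA3]
    exact le_max_right _ _

theorem closest_mem_slot {S : Finset U} (hS : I.Feasible S) (s : U) (j : Fin I.k) :
    I.closest s j ∈ I.slot j := by
  have := (Profile.nearestIn_spec (P := I.pref) (A := (I.slot j : Set U)) s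
    (by simpa using slot_nonempty hS j)).1
  exact Finset.mem_coe.1 this

/-- The supplemented solution is feasible and contains the projections of the centers. -/
theorem supplement_projectedSet {S : Finset U} (hS : I.Feasible S) {T : List U}
    {M : List (Fin I.k)} (hM : M.Nodup) (hMT : M.length = T.length) :
    I.Feasible (supplement I (projectedSet I T M)) ∧
      ∀ (i : ℕ) (hi : i < T.length) (hi' : i < M.length),
        I.closest T[i] M[i] ∈ supplement I (projectedSet I T M) := by
  classical
  set rep : Fin I.k → U := fun j =>
    if h : M.idxOf j < T.length then I.closest T[M.idxOf j] j
    else (slot_nonempty hS j).choose with hrep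
  have hrep_mem : ∀ j, rep j ∈ I.slot j := by
    intro j
    simp only [hrep]
    split
    · exact closest_mem_slot hS _ _
    · exact (slot_nonempty hS j).choose_spec
  have hrep_get : ∀ (i : ℕ) (hi : i < T.length) (hi' : i < M.length),
      rep M[i] = I.closest T[i] M[i] := by
    intro i hi hi'
    have : M.idxOf M[i] = i := hM.idxOf_getElem i hi'
    simp only [hrep, this, dif_pos hi]
  have hsub : projectedSet I T M ⊆ Finset.univ.image rep := by
    intro x hx
    rw [projectedSet, Finset.mem_union] at hx
    rw [Finset.mem_image]
    rcases hx with hx | hx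
    · rw [List.mem_toFinset, List.mem_iff_getElem] at hx
      obtain ⟨i, hi, rfl⟩ := hx
      rw [List.length_zipWith] at hi
      refine ⟨M[i]'(by omega), Finset.mem_univ _, ?_⟩
      rw [hrep_get i (by omega), List.getElem_zipWith]
    · obtain ⟨j, hj, hx⟩ := Finset.mem_biUnion.1 hx
      have hj : j ∉ M := (Finset.mem_filter.1 hj).2
      rw [dif_pos (slot_nonempty hS j), Finset.mem_singleton] at hx
      refine ⟨j, Finset.mem_univ _, ?_⟩
      have : ¬ M.idxOf j < T.length := by
        rw [← hMT, List.idxOf_lt_length_iff]; exact hj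
      rw [hx]
      simp only [hrep, dif_neg this]
  have hex : ∃ S', projectedSet I T M ⊆ S' ∧ I.Feasible S' := by
    obtain ⟨S', h1, h2⟩ := exists_feasible_superset hS rep hrep_mem
    exact ⟨S', fun x hx => h1 (by simpa using hsub hx), h2⟩
  have hdef : supplement I (projectedSet I T M) = hex.choose := by
    rw [supplement, dif_pos hex]
  rw [hdef]
  refine ⟨hex.choose_spec.2, fun i hi hi' => hex.choose_spec.1 ?_⟩
  rw [projectedSet, Finset.mem_union]
  left
  rw [List.mem_toFinset, List.mem_iff_getElem]
  exact ⟨i, by rw [List.length_zipWith]; omega, by rw [List.getElem_zipWith]⟩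

end Slots

/-! ### The distortion and the number of queries of the algorithm -/

section Assembly

variable {U : Type} [Fintype U] [MetricSpace U] {I : OrdFairInstance U}

/-- Either the centers of `T` can be projected with threshold `o`, where `o` is the cost of a
feasible solution, or the centers before the last one have cost at most `4 * o`. -/
theorem matchable_or_cover {T : List U} (hT : HalfGreedyList T) {S : Finset U}
    (hS : I.Feasible S) (hI : I.pref.Consistent) {o : ℝ} (hcov : ∀ u, ∃ s ∈ S, dist u s ≤ o) :
    Matchable I T o ∨ ∀ u, ∃ s ∈ T.dropLast, dist u s ≤ 4 * o := by
  rcases hT.pairwise_or_cover (2 * o) with hp | hc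
  · left
    obtain ⟨f, hf, hnd⟩ := exists_injective_assignment hcov hp
    obtain ⟨g, hg, hgs⟩ := exists_slot_assignment hS
    refine ⟨(T.map f).map g, ?_, ?_⟩
    · refine hnd.map_on fun x hx y hy hxy => ?_
      obtain ⟨a, -, rfl⟩ := List.mem_map.1 hx
      obtain ⟨b, -, rfl⟩ := List.mem_map.1 hy
      exact hg (hf a).1 (hf b).1 hxy
    · rw [List.map_map, List.forall₂_map_left_iff, List.forall₂_same]
      intro s _
      refine le_trans ?_ (hf s).2
      exact hI.dist_nearestIn_le s (Finset.mem_coe.2 (hgs _ (hf s).1))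
  · right
    intro u
    obtain ⟨s, hs, hus⟩ := hc u
    exact ⟨s, hs, by linarith⟩

/-- The search makes `O(log k)` rounds, each with `O(k log k)` queries; `Nat.size k` is the number of
binary digits of `k`. -/
theorem count_findLambda_le (hI : I.pref.Consistent) {T : List U} (hT : T ≠ [])
    (hTk : T.length ≤ I.k) :
    (findLambda I T).count dist ≤ 19 * (I.k * Nat.size I.k ^ 2) := by
  have h := (findLambda_spec hI hT hTk).2.2.2
  have hs : 1 ≤ Nat.size I.k := Nat.size_pos.2 I.one_le_k
  generalize Nat.size I.k = s at *
  calc (findLambda I T).count dist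
      ≤ T.length + (5 * s + 1) * (T.length * (1 + 2 * s)) := h
    _ ≤ I.k + (6 * s) * (I.k * (3 * s)) := by gcongr <;> omega
    _ ≤ I.k * s ^ 2 + (6 * s) * (I.k * (3 * s)) := by
        have : 1 ≤ s ^ 2 := Nat.one_le_pow _ _ hs
        nlinarith
    _ = 19 * (I.k * s ^ 2) := by ring

theorem count_evalPredicate_le' {T : List U} (hT : T.length = I.k) (l : ℕ) :
    (evalPredicate I T l).count dist ≤ 2 * (I.k * Nat.size I.k) := by
  have h := count_evalPredicate_le I T l
  have hs : 1 ≤ Nat.size I.k := Nat.size_pos.2 I.one_le_k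
  rw [hT] at h
  nlinarith [Nat.mul_le_mul_left I.k hs]

/-- The main phase stops at a prefix of the centers whose cost together with the projection
threshold is at most five times the cost of any feasible solution. -/
theorem mainPhase_spec (hI : I.pref.Consistent) {T : List U} (hT : HalfGreedyList T)
    (hTk : T.length = I.k) :
    1 ≤ (mainPhase I T).run dist ∧ (mainPhase I T).run dist ≤ I.k ∧
      (∀ (S : Finset U) (o : ℝ), I.Feasible S → 0 ≤ o → (∀ u, ∃ s ∈ S, dist u s ≤ o) →
        (coverCost I (T.take ((mainPhase I T).run dist))).run dist +
          ((findLambda I (T.take ((mainPhase I T).run dist))).run dist).best ≤ 5 * o) ∧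
      (mainPhase I T).count dist ≤ 26 * (I.k * Nat.size I.k ^ 2) := by
  have hk := I.one_le_k
  have hlen : ∀ l, l ≤ I.k → (T.take l).length = l := fun l hl => by
    rw [List.length_take, hTk]; omega
  have hne : ∀ l, 1 ≤ l → l ≤ I.k → T.take l ≠ [] := fun l h1 h2 h => by
    have := hlen l h2
    rw [h] at this
    simp at this
    omega
  have hdrop : ∀ l, l + 1 ≤ I.k → (T.take (l + 1)).dropLast = T.take l := fun l hl => by
    rw [List.dropLast_eq_take, hlen _ hl, List.take_take]
    congr 1
    omega
  have hspec := fun l (h1 : 1 ≤ l) (h2 : l ≤ I.k) =>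
    findLambda_spec hI (hne l h1 h2) ((hlen l h2).le.trans h2)
  -- the test of the main phase compares the cost with the projection threshold
  have hpred : ∀ l, 1 ≤ l → l ≤ I.k → ((evalPredicate I T l).run dist = true ↔
      4 * ((findLambda I (T.take l)).run dist).best ≤ (coverCost I (T.take l)).run dist) := by
    intro l h1 h2
    obtain ⟨-, g2, g3, -⟩ := hspec l h1 h2
    rw [run_evalPredicate hI]
    refine ⟨fun h => by linarith [g3 _ h], fun h => g2.mono I (by linarith)⟩
  have hopt : ∀ l, l + 1 ≤ I.k → ∀ (S : Finset U) (o : ℝ), I.Feasible S → 0 ≤ o →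
      (∀ u, ∃ s ∈ S, dist u s ≤ o) → ((findLambda I (T.take (l + 1))).run dist).best ≤ o ∨
        (1 ≤ l ∧ (coverCost I (T.take l)).run dist ≤ 4 * o) := by
    intro l hl S o hS ho hcov
    rcases matchable_or_cover (hT.take (l + 1)) hS hI hcov with h | h
    · exact Or.inl ((hspec (l + 1) (by omega) hl).2.2.1 o h)
    · rw [hdrop l hl] at h
      refine Or.inr ⟨?_, coverCost_le hI (by linarith) h⟩
      rcases Nat.eq_zero_or_pos l with rfl | hl0
      · obtain ⟨s, hs, -⟩ := h (T.head (by rintro rfl; simp at hTk; omega))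
        simp at hs
      · exact hl0
  have hfull : ∀ (S : Finset U) (o : ℝ), I.Feasible S → 0 ≤ o →
      (∀ u, ∃ s ∈ S, dist u s ≤ o) → (coverCost I (T.take I.k)).run dist ≤ 4 * o := by
    intro S o hS ho hcov
    exact coverCost_le hI (by linarith) ((hT.take I.k).cover_of_card_le
      (by rw [hlen _ le_rfl, hS.1]) ho hcov)
  have hs : 1 ≤ Nat.size I.k := Nat.size_pos.2 hk
  have hc1 := fun l => count_evalPredicate_le' (I := I) hTk l
  have hkk : I.k * Nat.size I.k ≤ I.k * Nat.size I.k ^ 2 :=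
    Nat.mul_le_mul_left _ (Nat.le_self_pow two_ne_zero _)
  have hkk' : I.k ≤ I.k * Nat.size I.k := by nlinarith
  rw [mainPhase]
  simp only [QueryM.run_bind, QueryM.count_bind]
  by_cases h1 : (evalPredicate I T 1).run dist = true
  swap
  · rw [if_neg h1]
    simp only [QueryM.run_pure, QueryM.count_pure]
    refine ⟨le_rfl, hk, fun S o hS ho hcov => ?_, by linarith [hc1 1]⟩
    rw [hpred 1 le_rfl hk, not_le] at h1
    rcases hopt 0 hk S o hS ho hcov with h | ⟨h, -⟩
    · linarith
    · omega
  rw [if_pos h1]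
  simp only [QueryM.run_bind, QueryM.count_bind]
  by_cases h2 : (evalPredicate I T I.k).run dist = true
  · rw [if_pos h2]
    simp only [QueryM.run_pure, QueryM.count_pure]
    refine ⟨hk, le_rfl, fun S o hS ho hcov => ?_, by linarith [hc1 1, hc1 I.k]⟩
    rw [hpred I.k hk le_rfl] at h2
    linarith [hfull S o hS ho hcov]
  rw [if_neg h2]
  simp only [QueryM.run_bind, QueryM.count_bind, QueryM.run_pure, QueryM.count_pure]
  obtain ⟨hL1, hL2, hL3, hL4⟩ := run_binarySearch dist (evalPredicate I T) I.k 1 I.k hk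
    (by omega) h1
  have hcb := count_binarySearch_le dist (evalPredicate I T) _ I.k (fun l _ => hc1 l) I.k 1 I.k
    le_rfl
  generalize (binarySearch (evalPredicate I T) I.k 1 I.k).run dist = L at *
  have hLk : L < I.k := by
    rcases hL2.lt_or_eq with h | rfl
    · exact h
    · exact absurd hL3 h2
  have hL4 := hL4 hLk
  rw [hpred L hL1 hL2] at hL3
  have hL4 : (coverCost I (T.take (L + 1))).run dist <
      4 * ((findLambda I (T.take (L + 1))).run dist).best := by
    rw [← not_le, ← hpred (L + 1) (by omega) hLk, hL4]
    simp
  refine ⟨by split <;> omega, by split <;> omega, fun S o hS ho hcov => ?_, ?_⟩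
  · split
    · rename_i hle
      rcases hopt L hLk S o hS ho hcov with h | ⟨-, h⟩ <;> linarith
    · rename_i hlt
      rw [not_le] at hlt
      rcases hopt L hLk S o hS ho hcov with h | ⟨-, h⟩ <;> linarith
  · have h3 := count_findLambda_le hI (hne (L + 1) (by omega) hLk) ((hlen _ hLk).le.trans hLk)
    have h4 := count_coverCost_le I (T.take L)
    rw [hlen L hL2] at h4
    have h5 : Nat.size (I.k - 1) * (2 * (I.k * Nat.size I.k)) ≤
        Nat.size I.k * (2 * (I.k * Nat.size I.k)) :=
      Nat.mul_le_mul_right _ (Nat.size_le_size (by omega))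
    have h6 : Nat.size I.k * (2 * (I.k * Nat.size I.k)) = 2 * (I.k * Nat.size I.k ^ 2) := by ring
    linarith [hc1 1, hc1 I.k]

/-- Every solution computed from a half-greedy traversal is feasible and costs at most five times
as much as any other feasible solution. -/
theorem ordFairKCenter_spec {init : InitialPhase} {c : ℝ} (h : IsHalfGreedy init c)
    (hI : I.pref.Consistent) {S : Finset U} (hS : I.Feasible S) :
    I.Feasible ((ordFairKCenter init U I).run dist) ∧
      socialCost (((ordFairKCenter init U I).run dist : Finset U) : Set U) ≤
        5 * socialCost (S : Set U) ∧
      ((ordFairKCenter init U I).count dist : ℝ) ≤ c * I.k + 45 * (I.k * Nat.size I.k ^ 2) := by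
  obtain ⟨i1, i2, i3, i4⟩ := h U I.pref I.k hI I.one_le_k (hS.1 ▸ Finset.card_le_univ S)
  have hg := halfGreedyList_iff.2 i3
  rw [ordFairKCenter]
  simp only [QueryM.run_bind, QueryM.count_bind, QueryM.run_pure, QueryM.count_pure]
  generalize hT : (init U I.pref I.k).run dist = T at *
  obtain ⟨m1, m2, m3, m4⟩ := mainPhase_spec hI hg i1
  generalize (mainPhase I T).run dist = l at *
  have hlen : (T.take l).length = l := by rw [List.length_take, i1]; omega
  have hne : T.take l ≠ [] := fun h => by rw [h] at hlen; simp at hlen; omega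
  obtain ⟨f1, f2, f3, -⟩ := findLambda_spec hI hne (hlen.le.trans m2)
  have hc := count_findLambda_le hI hne (hlen.le.trans m2)
  have hM : ∃ M, IsLeftPerfectMatching ((findLambda I (T.take l)).run dist).graph M := by
    obtain ⟨M, hM⟩ := f2
    exact ⟨M, by rw [f1]; exact (isLeftPerfectMatching_graphAt I _ _ M).2 hM⟩
  have hspec := hM.choose_spec
  rw [finalSolution, dif_pos hM]
  generalize hM.choose = M at *
  rw [f1] at hspec
  obtain ⟨n1, n2⟩ := (isLeftPerfectMatching_graphAt I _ _ M).1 hspec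
  obtain ⟨s1, s2⟩ := supplement_projectedSet hS n1 n2.length_eq
  refine ⟨s1, ?_, ?_⟩
  · obtain ⟨o, ho, hcost, hcov⟩ := exists_socialCost_eq_ofReal (S := S)
      (Finset.card_pos.1 (by rw [hS.1]; exact I.one_le_k))
    rw [hcost, show (5 : ℝ≥0∞) = ENNReal.ofReal 5 by simp, ← ENNReal.ofReal_mul (by norm_num)]
    refine socialCost_le_ofReal fun u => ?_
    obtain ⟨s, hs, hus⟩ := exists_dist_le_coverCost hI hne u
    obtain ⟨i, hi, rfl⟩ := List.mem_iff_getElem.1 hs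
    have hi' : i < M.length := by rw [n2.length_eq]; exact hi
    refine ⟨_, Finset.mem_coe.2 (s2 i hi hi'), ?_⟩
    have h1 := dist_triangle u (T.take l)[i] (I.closest (T.take l)[i] M[i])
    have h2 : dist (T.take l)[i] (I.closest (T.take l)[i] M[i]) ≤
        ((findLambda I (T.take l)).run dist).best := by
      simpa [OrdFairInstance.groupDist] using (List.forall₂_iff_get.1 n2).2 i hi' hi
    linarith [m3 S o hS ho hcov]
  · have h1 : ((mainPhase I T).count dist : ℝ) ≤ 26 * (I.k * Nat.size I.k ^ 2) := by
      exact_mod_cast m4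
    have h2 : ((findLambda I (T.take l)).count dist : ℝ) ≤ 19 * (I.k * Nat.size I.k ^ 2) := by
      exact_mod_cast hc
    push_cast
    linarith

theorem size_le_two_mul_logb {k : ℕ} (hk : 2 ≤ k) : (Nat.size k : ℝ) ≤ 2 * Real.logb 2 k := by
  have h1 : 1 ≤ Real.logb 2 k := by
    rw [Real.le_logb_iff_rpow_le (by norm_num) (by positivity)]
    simpa using (by exact_mod_cast hk : (2 : ℝ) ≤ k)
  have h2 : 2 ^ (Nat.size k - 1) ≤ k := by
    have : Nat.size k - 1 < Nat.size k := by
      have := Nat.size_pos.2 (show 0 < k by omega)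
      omega
    exact Nat.lt_size.1 this
  have h3 : ((Nat.size k - 1 : ℕ) : ℝ) ≤ Real.logb 2 k := by
    rw [Real.le_logb_iff_rpow_le (by norm_num) (by positivity), Real.rpow_natCast]
    exact_mod_cast h2
  have h4 : (Nat.size k : ℝ) ≤ ((Nat.size k - 1 : ℕ) : ℝ) + 1 := by
    norm_cast; omega
  linarith

end Assembly

theorem IsHalfGreedy.solvesWithFiveDistortion {init : InitialPhase} {c : ℝ}
    (h : IsHalfGreedy init c) : SolvesWithFiveDistortion (ordFairKCenter init) (|c| + 180) := by
  refine ⟨fun U _ _ I hI ⟨S, hS⟩ => ?_, ?_⟩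
  · obtain ⟨h1, -, h3⟩ := ordFairKCenter_spec h hI hS
    refine ⟨h1, fun hk => h3.trans ?_, fun hk => h3.trans ?_⟩
    · have hs := size_le_two_mul_logb hk
      have hL : 1 ≤ Real.logb 2 I.k := by
        rw [Real.le_logb_iff_rpow_le (by norm_num) (by positivity)]
        simpa using (by exact_mod_cast hk : (2 : ℝ) ≤ I.k)
      have hs2 : (Nat.size I.k : ℝ) ^ 2 ≤ (2 * Real.logb 2 I.k) ^ 2 :=
        pow_le_pow_left₀ (by positivity) hs 2
      have hk0 : (0 : ℝ) ≤ I.k := by positivity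
      have e1 : c * I.k ≤ |c| * (I.k * Real.logb 2 I.k ^ 2) := by
        calc c * I.k ≤ |c| * I.k := mul_le_mul_of_nonneg_right (le_abs_self c) hk0
          _ ≤ |c| * (I.k * Real.logb 2 I.k ^ 2) :=
            mul_le_mul_of_nonneg_left (le_mul_of_one_le_right hk0 (one_le_pow₀ hL))
              (abs_nonneg c)
      have e2 : (I.k : ℝ) * Nat.size I.k ^ 2 ≤ I.k * (2 * Real.logb 2 I.k) ^ 2 :=
        mul_le_mul_of_nonneg_left hs2 hk0
      rw [add_mul]
      have e3 : (I.k : ℝ) * (2 * Real.logb 2 I.k) ^ 2 = 4 * (I.k * Real.logb 2 I.k ^ 2) := by ring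
      linarith
    · rw [hk, Nat.size_one]
      have := le_abs_self c
      norm_num
      linarith
  · refine iSup_le fun U => iSup_le fun _ => iSup_le fun _ => iSup_le fun I => iSup_le fun hI =>
      iSup_le fun _ => ?_
    refine ENNReal.div_le_of_le_mul ?_
    rw [ENNReal.mul_iInf_of_ne (by norm_num) (by norm_num)]
    refine le_iInf fun S => ?_
    rw [ENNReal.mul_iInf_of_ne (by norm_num) (by norm_num)]
    exact le_iInf fun hS => (ordFairKCenter_spec h hI hS).2.1

theorem mainTheorem1 :
    (∃ c : ℝ, IsHalfGreedy ordinalGreedy c) ∧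
    IsFourDistortionKCenter ordinalGreedy ∧
    (∃ C : ℝ, SolvesWithFiveDistortion (ordFairKCenter ordinalGreedy) C) ∧
    (∀ c : ℝ, ∃ C : ℝ, ∀ init : InitialPhase, IsHalfGreedy init c →
      SolvesWithFiveDistortion (ordFairKCenter init) C) :=
  ⟨⟨12, ordinalGreedy_isHalfGreedy⟩, ordinalGreedy_isHalfGreedy.isFourDistortionKCenter,
    ⟨_, ordinalGreedy_isHalfGreedy.solvesWithFiveDistortion⟩,
    fun _ => ⟨_, fun _ h => h.solvesWithFiveDistortion⟩⟩
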